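/- Let $n\ge 1$ and let $\Omega\subset\mathbb{R}^n$ be a domain (a nonempty connected open set) with locally Lipschitz boundary, i.e. every $x\in\partial\Omega$ has an open neighbourhood $U$ and a bi-Lipschitz map $\nu$ of $U$ onto a ball $B(0,r)$ with $\nu(U\cap\partial\Omega)\subset\{y_n=0\}$. Let $W^1_n(\Omega)$ be the Sobolev space of maps $\varphi:\Omega\to\mathbb{R}^n$ with $\varphi\in L_n(\Omega)$ and weak derivative $D\varphi\in L_n(\Omega)$. For $1\le m\le n$ and multi-indices $p=(p_1<\dots<p_m)$, $q=(q_1<\dots<q_m)$ in $\{1,\dots,n\}$, let $M^p_q(D\varphi)$ be the $m\times m$ minor of $D\varphi$ with rows $p_1,\dots,p_m$ and columns $q_1,\dots,q_m$, i.e. the determinant of the matrix with entries $\partial\varphi_{p_i}/\partial x_{q_j}$. Let $\varphi_0,\varphi_k\in W^1_n(\Omega)$, $k\in\mathbb{N}$. Then: 1. $M^p_q(D\varphi_0)\in L_{n/m}(\Omega)$ for all $1\le m\le n$ and all such $p,q$. 2. If $\varphi_k\to\varphi_0$ weakly in $W^1_n(\Omega)$ and if, for all $1\le m\le n$ and all such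 $p,q$, $M^p_q(D\varphi_k)\to H^p_q$ weakly in $L_{n/m}(\Omega)$ for some $H^p_q\in L_{n/m}(\Omega)$, then $H^p_q=M^p_q(D\varphi_0)$ almost everywhere in $\Omega$ for all $1\le m\le n$ and all such $p,q$. -/

import Mathlib

open MeasureTheory Filter Topology TopologicalSpace
open scoped ENNReal NNReal Distributions

noncomputable section

/-- `Euc n` is the Euclidean space `ℝⁿ`. -/
abbrev Euc (n : ℕ) : Type := EuclideanSpace ℝ (Fin n)

instance factOneLeNatCast (n : ℕ) [NeZero n] : Fact ((1 : ℝ≥0∞) ≤ (n : ℝ≥0∞)) :=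
  ⟨by exact_mod_cast Nat.one_le_iff_ne_zero.mpr (NeZero.ne n)⟩

/-- Locally Lipschitz boundary: every boundary point has an open neighbourhood `U` and a
bi-Lipschitz map `ν` of `U` onto a ball `B(0, r)` which sends the part of the boundary lying in `U`
into the hyperplane on which the last coordinate vanishes. -/
def HasLocallyLipschitzBoundary {n : ℕ} (Ω : Set (Euc n)) : Prop :=
  ∀ x ∈ frontier Ω, ∃ (U : Set (Euc n)) (r : ℝ) (ν : Euc n → Euc n) (L : ℝ),
    IsOpen U ∧ x ∈ U ∧ 0 < r ∧ ν '' U = Metric.ball 0 r ∧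
    (∀ a ∈ U, ∀ b ∈ U, dist (ν a) (ν b) ≤ L * dist a b ∧ dist a b ≤ L * dist (ν a) (ν b)) ∧
    ∀ y ∈ U ∩ frontier Ω, ∀ i : Fin n, (i : ℕ) + 1 = n → ν y i = 0

/-- `G` is the weak derivative of the map `u` on the open set `Ω`:
`∫_Ω (∂_v θ) u = - ∫_Ω θ (G v)` for all test functions `θ ∈ C₀^∞(Ω)` and all directions `v`. -/
def IsWeakDeriv {n : ℕ} (Ω : Opens (Euc n)) (u : Euc n → Euc n)
    (G : Euc n → Euc n →L[ℝ] Euc n) : Prop :=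
  ∀ (θ : 𝓓(Ω, ℝ)) (v : Euc n),
    ∫ x in (Ω : Set (Euc n)), (fderiv ℝ θ x v) • u x =
      - ∫ x in (Ω : Set (Euc n)), θ x • G x v

theorem testFunction_fderiv_smul_integrable {n : ℕ} {Ω : Opens (Euc n)} {p : ℝ≥0∞}
    [hp : Fact (1 ≤ p)] (θ : 𝓓(Ω, ℝ)) (v : Euc n)
    (u : Lp (Euc n) p (volume.restrict (Ω : Set (Euc n)))) :
    Integrable (fun x => (fderiv ℝ θ x v) • u x) (volume.restrict (Ω : Set (Euc n))) := by
  have hc : Continuous (fun x => fderiv ℝ θ x v) :=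
    (θ.contDiff.continuous_fderiv (by simp)).clm_apply continuous_const
  have hs : HasCompactSupport (fun x => fderiv ℝ θ x v) := θ.hasCompactSupport.fderiv_apply ℝ v
  have hl : LocallyIntegrable u (volume.restrict (Ω : Set (Euc n))) :=
    (Lp.memLp u).locallyIntegrable hp.out
  exact hl.integrable_smul_left_of_hasCompactSupport hc hs

theorem testFunction_smul_apply_integrable {n : ℕ} {Ω : Opens (Euc n)} {p : ℝ≥0∞}
    [hp : Fact (1 ≤ p)] (θ : 𝓓(Ω, ℝ)) (v : Euc n)
    (G : Lp (Euc n →L[ℝ] Euc n) p (volume.restrict (Ω : Set (Euc n)))) :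
    Integrable (fun x => θ x • G x v) (volume.restrict (Ω : Set (Euc n))) := by
  have hl : LocallyIntegrable G (volume.restrict (Ω : Set (Euc n))) :=
    (Lp.memLp G).locallyIntegrable hp.out
  have h := hl.integrable_smul_left_of_hasCompactSupport θ.contDiff.continuous
    θ.hasCompactSupport
  simpa using h.apply_continuousLinearMap v

/-- The Sobolev space `W^1_p(Ω)` of maps `Ω → ℝⁿ`: pairs `(u, Du)`, where `u ∈ L_p(Ω)` and
`Du ∈ L_p(Ω)` is the weak derivative of `u`. It is a normed space with the norm
`max (‖u‖_p) (‖Du‖_p)`, which is equivalent to the other usual norms of `W^1_p(Ω)`. -/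
def Sobolev {n : ℕ} (Ω : Opens (Euc n)) (p : ℝ≥0∞) [Fact (1 ≤ p)] :
    Submodule ℝ (Lp (Euc n) p (volume.restrict (Ω : Set (Euc n))) ×
      Lp (Euc n →L[ℝ] Euc n) p (volume.restrict (Ω : Set (Euc n)))) where
  carrier := {w | IsWeakDeriv Ω w.1 w.2}
  zero_mem' := by
    intro θ v
    have h1 : ∫ x in (Ω : Set (Euc n)), (fderiv ℝ θ x v) •
        (0 : Lp (Euc n) p (volume.restrict (Ω : Set (Euc n)))) x = 0 := by
      refine integral_eq_zero_of_ae ?_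
      filter_upwards [Lp.coeFn_zero (Euc n) p (volume.restrict (Ω : Set (Euc n)))] with x hx
      rw [hx]; simp
    have h2 : ∫ x in (Ω : Set (Euc n)), θ x •
        (0 : Lp (Euc n →L[ℝ] Euc n) p (volume.restrict (Ω : Set (Euc n)))) x v = 0 := by
      refine integral_eq_zero_of_ae ?_
      filter_upwards [Lp.coeFn_zero (Euc n →L[ℝ] Euc n) p
        (volume.restrict (Ω : Set (Euc n)))] with x hx
      rw [hx]; simp
    exact h1.trans (by rw [← neg_zero, ← h2]; rfl)
  add_mem' := by
    rintro ⟨u, G⟩ ⟨u', G'⟩ h h' θ v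
    have h1 : ∫ x in (Ω : Set (Euc n)), (fderiv ℝ θ x v) • (u + u') x =
        (∫ x in (Ω : Set (Euc n)), (fderiv ℝ θ x v) • u x) +
          ∫ x in (Ω : Set (Euc n)), (fderiv ℝ θ x v) • u' x := by
      rw [← integral_add (testFunction_fderiv_smul_integrable θ v u)
        (testFunction_fderiv_smul_integrable θ v u')]
      refine integral_congr_ae ?_
      filter_upwards [Lp.coeFn_add u u'] with x hx
      rw [hx, Pi.add_apply, smul_add]
    have h2 : ∫ x in (Ω : Set (Euc n)), θ x • (G + G') x v =
        (∫ x in (Ω : Set (Euc n)), θ x • G x v) +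
          ∫ x in (Ω : Set (Euc n)), θ x • G' x v := by
      rw [← integral_add (testFunction_smul_apply_integrable θ v G)
        (testFunction_smul_apply_integrable θ v G')]
      refine integral_congr_ae ?_
      filter_upwards [Lp.coeFn_add G G'] with x hx
      rw [hx, Pi.add_apply, add_apply, smul_add]
    have e := h θ v
    have e' := h' θ v
    dsimp only at e e'
    change ∫ x in (Ω : Set (Euc n)), (fderiv ℝ θ x v) • (u + u') x =
      - ∫ x in (Ω : Set (Euc n)), θ x • (G + G') x v
    rw [h1, h2, e, e', neg_add]
  smul_mem' := by
    rintro c ⟨u, G⟩ h θ v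
    have h1 : ∫ x in (Ω : Set (Euc n)), (fderiv ℝ θ x v) • (c • u) x =
        c • ∫ x in (Ω : Set (Euc n)), (fderiv ℝ θ x v) • u x := by
      rw [← integral_smul]
      refine integral_congr_ae ?_
      filter_upwards [Lp.coeFn_smul c u] with x hx
      simp only [hx, Pi.smul_apply]
      exact smul_comm _ _ _
    have h2 : ∫ x in (Ω : Set (Euc n)), θ x • (c • G) x v =
        c • ∫ x in (Ω : Set (Euc n)), θ x • G x v := by
      rw [← integral_smul]
      refine integral_congr_ae ?_
      filter_upwards [Lp.coeFn_smul c G] with x hx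
      simp only [hx, Pi.smul_apply, smul_apply]
      exact smul_comm _ _ _
    have e := h θ v
    dsimp only at e
    change ∫ x in (Ω : Set (Euc n)), (fderiv ℝ θ x v) • (c • u) x =
      - ∫ x in (Ω : Set (Euc n)), θ x • (c • G) x v
    rw [h1, h2, e, smul_neg]

/-- The weak derivative `Dφ` of a Sobolev map `φ` (defined almost everywhere in `Ω`). -/
def Sobolev.deriv {n : ℕ} {Ω : Opens (Euc n)} {p : ℝ≥0∞} [Fact (1 ≤ p)] (φ : Sobolev Ω p) :
    Euc n → Euc n →L[ℝ] Euc n :=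
  φ.1.2

/-- The Jacobi matrix of a linear map; the matrix of `Dφ(x)` has entries `∂φ_i / ∂x_j (x)`. -/
def jacobiMatrix {n : ℕ} (A : Euc n →L[ℝ] Euc n) : Matrix (Fin n) (Fin n) ℝ :=
  Matrix.of fun i j => A (EuclideanSpace.single j 1) i

/-- The minor `M^p_q(Dφ)` with rows `p_1 < ... < p_m` and columns `q_1 < ... < q_m`. -/
def Sobolev.minor {n m : ℕ} {Ω : Opens (Euc n)} {s : ℝ≥0∞} [Fact (1 ≤ s)] (φ : Sobolev Ω s)
    (p q : Fin m ↪o Fin n) : Euc n → ℝ :=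
  fun x => ((jacobiMatrix (Sobolev.deriv φ x)).submatrix p q).det

/-- Weak convergence of a sequence in a normed space. -/
def WeaklyConverges {V : Type*} [NormedAddCommGroup V] [NormedSpace ℝ V] (v : ℕ → V) (v₀ : V) :
    Prop :=
  Tendsto (fun k => toWeakSpace ℝ V (v k)) atTop (𝓝 (toWeakSpace ℝ V v₀))

/-- The functions `f k` and `g` belong to `L_s(Ω)`, `1 ≤ s`, and `f k → g` weakly in `L_s(Ω)`. -/
def WeaklyConvergesInLp {n : ℕ} (Ω : Opens (Euc n)) (s : ℝ≥0∞) (f : ℕ → Euc n → ℝ)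
    (g : Euc n → ℝ) : Prop :=
  ∃ (_ : Fact (1 ≤ s)) (hf : ∀ k, MemLp (f k) s (volume.restrict (Ω : Set (Euc n))))
    (hg : MemLp g s (volume.restrict (Ω : Set (Euc n)))),
    WeaklyConverges (fun k => (hf k).toLp) hg.toLp

end

/-!
The minors of a gradient matrix converge weakly because each of them is a divergence. Expanding
`M^p_q(Dφ)` along its first row and integrating by parts against a test function `θ` gives
`∫ θ M^p_q(Dφ) = -∑_j (-1)^j ∫ (∂_{q_j} θ) φ_{p_0} M^{p'}_{q^j}(Dφ)`, where `p'` and `q^j` omit the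
first row and the `j`-th column (`Sobolev.integral_testFunction_mul_minor`). There are no further
terms, since the cofactors of a gradient matrix form divergence-free fields.

The limit is then identified by induction on the order of the minor. In the formula above the factor
`(∂_{q_j} θ) φ_{p_0}` converges in the norm of `L_n` (Rellich's theorem,
`Sobolev.tendstoInLp_cut`), hence in the norm of the dual of `L_{n/m}`, while the minor of order `m`
converges weakly in `L_{n/m}`, to the correct limit by the induction hypothesis. So the products
converge (`Sobolev.tendsto_integral_cut_mul_minor`), and the minors of order `m + 1` converge as
distributions to the minors of the limit map (`Sobolev.tendsto_integral_minor_succ`), which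
therefore agree with the weak limits.

The formula is equivalent to `∫ det (∂_{v_j} g_i) = 0` for functions `g_0, …, g_m`, one of them
with compact support. For smooth functions this follows from integration by parts and the symmetry
of second derivatives (`integral_det_fderiv_eq_zero`). It passes to Sobolev functions by
mollification, as determinants of order `m + 1` are continuous from `L_n` to `L_{n/(m+1)}`. Maps
on `Ω` are multiplied by test functions and extended by zero, which reduces everything to the whole
space.
-/

/-! ### Norm convergence in `L_p` -/

section TendstoInLp

variable {α ι : Type*} {mα : MeasurableSpace α} {μ : Measure α} {l : Filter ι}

/-- The functions `F i` and `f` belong to `L_p(μ)`, and `F i → f` in the norm of `L_p(μ)` along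
the filter `l`. -/
def TendstoInLp (p : ℝ≥0∞) (μ : Measure α) (l : Filter ι) (F : ι → α → ℝ) (f : α → ℝ) : Prop :=
  (∀ i, MemLp (F i) p μ) ∧ MemLp f p μ ∧ Tendsto (fun i => eLpNorm (F i - f) p μ) l (𝓝 0)

namespace TendstoInLp

variable {p q r : ℝ≥0∞} {F G : ι → α → ℝ} {f g : α → ℝ}

theorem const (hf : MemLp f p μ) : TendstoInLp p μ l (fun _ => f) f := by
  refine ⟨fun _ => hf, hf, ?_⟩
  simpa using tendsto_const_nhds

theorem add (hp : 1 ≤ p) (hF : TendstoInLp p μ l F f) (hG : TendstoInLp p μ l G g) :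
    TendstoInLp p μ l (fun i => F i + G i) (f + g) := by
  refine ⟨fun i => (hF.1 i).add (hG.1 i), hF.2.1.add hG.2.1, ?_⟩
  refine tendsto_of_tendsto_of_tendsto_of_le_of_le tendsto_const_nhds
    (by simpa using hF.2.2.add hG.2.2) (fun _ => zero_le) fun i => ?_
  have : F i + G i - (f + g) = (F i - f) + (G i - g) := by abel
  rw [this]
  exact eLpNorm_add_le ((hF.1 i).sub hF.2.1).1 ((hG.1 i).sub hG.2.1).1 hp

theorem const_mul (c : ℝ) (hF : TendstoInLp p μ l F f) :
    TendstoInLp p μ l (fun i x => c * F i x) (fun x => c * f x) := by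
  refine ⟨fun i => (hF.1 i).const_mul c, hF.2.1.const_mul c, ?_⟩
  have h : ∀ i, eLpNorm ((fun x => c * F i x) - fun x => c * f x) p μ =
      ‖c‖ₑ * eLpNorm (F i - f) p μ := by
    intro i
    rw [← eLpNorm_const_smul]
    congr 1
    ext x
    simp [mul_sub]
  simp_rw [h]
  simpa using ENNReal.Tendsto.const_mul hF.2.2 (Or.inr enorm_ne_top)

theorem sum {κ : Type*} (s : Finset κ) (hp : 1 ≤ p) {F : κ → ι → α → ℝ} {f : κ → α → ℝ}
    (h : ∀ k ∈ s, TendstoInLp p μ l (F k) (f k)) :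
    TendstoInLp p μ l (fun i x => ∑ k ∈ s, F k i x) (fun x => ∑ k ∈ s, f k x) := by
  classical
  induction s using Finset.induction_on with
  | empty => simpa using const (l := l) (MemLp.zero' (p := p) (μ := μ) (ε := ℝ))
  | insert a s ha ih =>
    simp_rw [Finset.sum_insert ha]
    exact (h a (Finset.mem_insert_self a s)).add hp
      (ih fun k hk => h k (Finset.mem_insert_of_mem hk))

/-- Hölder's inequality: products of convergent sequences converge. -/
theorem mul [p.HolderTriple q r] (hr : 1 ≤ r) (hF : TendstoInLp p μ l F f)
    (hG : TendstoInLp q μ l G g) : TendstoInLp r μ l (fun i => F i * G i) (f * g) := by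
  refine ⟨fun i => (hG.1 i).mul (hF.1 i), hG.2.1.mul hF.2.1, ?_⟩
  have holder : ∀ {u v : α → ℝ}, AEStronglyMeasurable u μ → AEStronglyMeasurable v μ →
      eLpNorm (u * v) r μ ≤ eLpNorm u p μ * eLpNorm v q μ := fun {u v} hu hv =>
    eLpNorm_smul_le_mul_eLpNorm (φ := u) (f := v) hv hu
  have key : ∀ i, eLpNorm (F i * G i - f * g) r μ ≤
      eLpNorm (F i - f) p μ * eLpNorm (G i - g) q μ + eLpNorm (F i - f) p μ * eLpNorm g q μ
        + eLpNorm f p μ * eLpNorm (G i - g) q μ := by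
    intro i
    have h1 := ((hF.1 i).sub hF.2.1)
    have h2 := ((hG.1 i).sub hG.2.1)
    have e : F i * G i - f * g = (F i - f) * (G i - g) + (F i - f) * g + f * (G i - g) := by ring
    rw [e]
    refine (eLpNorm_add_le ((h1.1.mul h2.1).add (h1.1.mul hG.2.1.1)) (hF.2.1.1.mul h2.1) hr).trans
      (add_le_add ((eLpNorm_add_le (h1.1.mul h2.1) (h1.1.mul hG.2.1.1) hr).trans
        (add_le_add ?_ ?_)) ?_)
    · exact holder h1.1 h2.1
    · exact holder h1.1 hG.2.1.1
    · exact holder hF.2.1.1 h2.1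
  refine tendsto_of_tendsto_of_tendsto_of_le_of_le tendsto_const_nhds ?_ (fun _ => zero_le) key
  have t1 := ENNReal.Tendsto.mul hF.2.2 (Or.inr ENNReal.zero_ne_top) hG.2.2
    (Or.inr ENNReal.zero_ne_top)
  have t2 := ENNReal.Tendsto.mul_const (b := eLpNorm g q μ) hF.2.2 (Or.inr hG.2.1.2.ne)
  have t3 := ENNReal.Tendsto.const_mul (a := eLpNorm f p μ) hG.2.2 (Or.inr hF.2.1.2.ne)
  simpa using (t1.add t2).add t3

theorem mono_exponent [IsFiniteMeasure μ] (hpq : p ≤ q) (hF : TendstoInLp q μ l F f) :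
    TendstoInLp p μ l F f := by
  refine ⟨fun i => (hF.1 i).mono_exponent hpq, hF.2.1.mono_exponent hpq, ?_⟩
  rcases eq_or_ne p 0 with rfl | hp
  · simpa using tendsto_const_nhds
  have hC : μ Set.univ ^ (1 / p.toReal - 1 / q.toReal) ≠ ∞ := by
    refine ENNReal.rpow_ne_top_of_nonneg ?_ (measure_ne_top _ _)
    rcases eq_or_ne q ∞ with rfl | hq
    · simp
    · exact sub_nonneg.2 (one_div_le_one_div_of_le
        (ENNReal.toReal_pos hp (ne_top_of_le_ne_top hq hpq)) (ENNReal.toReal_mono hq hpq))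
  refine tendsto_of_tendsto_of_tendsto_of_le_of_le tendsto_const_nhds
    (zero_mul (μ Set.univ ^ (1 / p.toReal - 1 / q.toReal)) ▸
      ENNReal.Tendsto.mul_const hF.2.2 (Or.inr hC)) (fun _ => zero_le) fun i => ?_
  exact eLpNorm_le_eLpNorm_mul_rpow_measure_univ hpq ((hF.1 i).sub hF.2.1).1

theorem restrict (s : Set α) (hF : TendstoInLp p μ l F f) : TendstoInLp p (μ.restrict s) l F f :=
  ⟨fun i => (hF.1 i).restrict s, hF.2.1.restrict s,
    tendsto_of_tendsto_of_tendsto_of_le_of_le tendsto_const_nhds hF.2.2 (fun _ => zero_le)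
      fun _ => eLpNorm_restrict_le _ _ _ _⟩

theorem tendsto_integral (hF : TendstoInLp 1 μ l F f) :
    Tendsto (fun i => ∫ x, F i x ∂μ) l (𝓝 (∫ x, f x ∂μ)) :=
  tendsto_integral_of_L1' f hF.2.1.1 (Eventually.of_forall fun i => memLp_one_iff_integrable.1
    (hF.1 i)) hF.2.2

/-- Functions vanishing outside a common set of finite measure: convergence in `L_p` implies
convergence in `L_s` for `s ≤ p`. -/
theorem mono_exponent_of_eq_zero {s : Set α} (hs : MeasurableSet s) (hμ : μ s ≠ ∞) (hpq : p ≤ q)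
    (hF : TendstoInLp q μ l F f) (hF0 : ∀ i, ∀ x ∉ s, F i x = 0) (hf0 : ∀ x ∉ s, f x = 0) :
    TendstoInLp p μ l F f := by
  have : IsFiniteMeasure (μ.restrict s) := ⟨by simpa using hμ.lt_top⟩
  have h := (hF.restrict s).mono_exponent hpq
  have e1 : ∀ i, s.indicator (F i) = F i := fun i =>
    Set.indicator_eq_self.2 fun x hx => by_contra fun h => hx (hF0 i x h)
  have e2 : s.indicator f = f :=
    Set.indicator_eq_self.2 fun x hx => by_contra fun h => hx (hf0 x h)
  refine ⟨fun i => e1 i ▸ (memLp_indicator_iff_restrict hs).2 (h.1 i),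
    e2 ▸ (memLp_indicator_iff_restrict hs).2 h.2.1, ?_⟩
  refine h.2.2.congr fun i => ?_
  rw [← eLpNorm_indicator_eq_eLpNorm_restrict hs, Set.indicator_sub', e1, e2]

end TendstoInLp

theorem holderTriple_natCast_div {n : ℕ} (hn : n ≠ 0) (m : ℕ) :
    ENNReal.HolderTriple ((n : ℝ≥0∞) / (m : ℝ≥0∞)) (n : ℝ≥0∞)
      ((n : ℝ≥0∞) / ((m + 1 : ℕ) : ℝ≥0∞)) := by
  constructor
  have hn' : (n : ℝ≥0∞) ≠ 0 := by exact_mod_cast hn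
  rw [ENNReal.inv_div (Or.inl (by simp)) (Or.inr hn'),
    ENNReal.inv_div (Or.inl (by simp)) (Or.inr hn'), ← one_div, ENNReal.div_add_div_same]
  push_cast
  rfl

theorem one_le_natCast_div {n m : ℕ} (hn : n ≠ 0) (hmn : m ≤ n) :
    1 ≤ (n : ℝ≥0∞) / (m : ℝ≥0∞) := by
  have hmn' : (m : ℝ≥0∞) ≤ n := by exact_mod_cast hmn
  rw [ENNReal.le_div_iff_mul_le (Or.inr (by exact_mod_cast hn)) (Or.inr (by simp))]
  simpa using hmn'

namespace TendstoInLp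

/-- A product of `m` sequences converging in `L_n` converges in `L_{n/m}`; for `m = 0` the exponent
is `∞`. -/
theorem prod {n : ℕ} (hn : n ≠ 0) {κ : Type*} (s : Finset κ) (hs : s.card ≤ n)
    {F : κ → ι → α → ℝ} {f : κ → α → ℝ}
    (h : ∀ k ∈ s, TendstoInLp (n : ℝ≥0∞) μ l (F k) (f k)) :
    TendstoInLp ((n : ℝ≥0∞) / (s.card : ℝ≥0∞)) μ l (fun i x => ∏ k ∈ s, F k i x)
      (fun x => ∏ k ∈ s, f k x) := by
  classical
  induction s using Finset.induction_on with
  | empty =>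
    have : MemLp (fun _ : α => (1 : ℝ)) ∞ μ := memLp_top_const 1
    simpa [ENNReal.div_zero, hn] using const (l := l) this
  | insert a s ha ih =>
    simp_rw [Finset.prod_insert ha]
    have hc := Finset.card_insert_of_notMem ha
    have h1 := ih (by omega) fun k hk => h k (Finset.mem_insert_of_mem hk)
    have h2 := h a (Finset.mem_insert_self a s)
    have := holderTriple_natCast_div hn s.card
    have h3 := h1.mul (r := (n : ℝ≥0∞) / ((s.card + 1 : ℕ) : ℝ≥0∞))
      (one_le_natCast_div hn (by omega)) h2
    have e : ∀ u v : α → ℝ, u * v = fun x => v x * u x := fun u v => by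
      ext x; exact mul_comm _ _
    rw [hc]
    simpa only [e] using h3

/-- Determinants of order `m` are continuous from `L_n` to `L_{n/m}`. -/
theorem det {n m : ℕ} (hn : n ≠ 0) (hmn : m ≤ n) {A : ι → α → Matrix (Fin m) (Fin m) ℝ}
    {B : α → Matrix (Fin m) (Fin m) ℝ}
    (h : ∀ a b, TendstoInLp (n : ℝ≥0∞) μ l (fun i x => A i x a b) (fun x => B x a b)) :
    TendstoInLp ((n : ℝ≥0∞) / (m : ℝ≥0∞)) μ l (fun i x => (A i x).det) (fun x => (B x).det) := by
  simp_rw [Matrix.det_apply']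
  refine sum _ (one_le_natCast_div hn hmn) fun σ _ => const_mul _ ?_
  simpa using prod hn Finset.univ (by simpa using hmn)
    (F := fun a i x => A i x (σ a) a) (f := fun a x => B x (σ a) a) fun a _ => h (σ a) a

end TendstoInLp

theorem memLp_det {n m : ℕ} (hn : n ≠ 0) (hmn : m ≤ n) {A : α → Matrix (Fin m) (Fin m) ℝ}
    (h : ∀ a b, MemLp (fun x => A x a b) (n : ℝ≥0∞) μ) :
    MemLp (fun x => (A x).det) ((n : ℝ≥0∞) / (m : ℝ≥0∞)) μ :=
  (TendstoInLp.det (l := (⊤ : Filter Unit)) hn hmn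
    (A := fun _ => A) fun a b => TendstoInLp.const (h a b)).2.1

end TendstoInLp

/-! ### Averages, translations and mollification in `L_p` -/

/-- Averaging over a probability measure does not increase the `L_p` norm (a form of Minkowski's
integral inequality). -/
theorem eLpNorm_integral_le_of_ae_le {X Y : Type*} {mX : MeasurableSpace X}
    {mY : MeasurableSpace Y} {ν : Measure X} [SFinite ν] {κ : Measure Y} [IsProbabilityMeasure κ]
    {F : X → Y → ℝ} (hF : AEStronglyMeasurable (Function.uncurry F) (ν.prod κ)) {p : ℝ≥0∞}
    (hp1 : 1 ≤ p) (hp : p ≠ ∞) {C : ℝ≥0∞} (h : ∀ᵐ y ∂κ, eLpNorm (fun x => F x y) p ν ≤ C) :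
    eLpNorm (fun x => ∫ y, F x y ∂κ) p ν ≤ C := by
  have hp0 : p ≠ 0 := (zero_lt_one.trans_le hp1).ne'
  have hr : 0 < p.toReal := ENNReal.toReal_pos hp0 hp
  have hJ : ∀ᵐ x ∂ν, ‖∫ y, F x y ∂κ‖ₑ ^ p.toReal ≤ ∫⁻ y, ‖F x y‖ₑ ^ p.toReal ∂κ := by
    filter_upwards [hF.prodMk_left] with x hx
    have h1 : ‖∫ y, F x y ∂κ‖ₑ ≤ eLpNorm (F x) p κ :=
      (enorm_integral_le_lintegral_enorm _).trans <| by
        rw [← eLpNorm_one_eq_lintegral_enorm]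
        exact eLpNorm_le_eLpNorm_of_exponent_le hp1 hx
    rw [eLpNorm_eq_lintegral_rpow_enorm_toReal hp0 hp, one_div] at h1
    exact (ENNReal.le_rpow_inv_iff hr).1 h1
  rw [eLpNorm_eq_lintegral_rpow_enorm_toReal hp0 hp, one_div, ENNReal.rpow_inv_le_iff hr]
  calc ∫⁻ x, ‖∫ y, F x y ∂κ‖ₑ ^ p.toReal ∂ν
      ≤ ∫⁻ x, ∫⁻ y, ‖F x y‖ₑ ^ p.toReal ∂κ ∂ν := lintegral_mono_ae hJ
    _ = ∫⁻ y, ∫⁻ x, ‖F x y‖ₑ ^ p.toReal ∂ν ∂κ := by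
        refine lintegral_lintegral_swap ?_
        exact hF.enorm.pow_const _
    _ ≤ ∫⁻ _, C ^ p.toReal ∂κ := by
        refine lintegral_mono_ae ?_
        filter_upwards [h] with y hy
        rw [eLpNorm_eq_lintegral_rpow_enorm_toReal hp0 hp, one_div,
          ENNReal.rpow_inv_le_iff hr] at hy
        exact hy
    _ = C ^ p.toReal := by simp

theorem eLpNorm_translate {E : Type*} [NormedAddCommGroup E] [MeasurableSpace E] [BorelSpace E]
    {μ : Measure E} [μ.IsAddRightInvariant] {p : ℝ≥0∞} {f : E → ℝ}
    (hf : AEStronglyMeasurable f μ) (y : E) : eLpNorm (fun x => f (x - y)) p μ = eLpNorm f p μ :=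
  eLpNorm_comp_measurePreserving hf (measurePreserving_sub_right μ y)

theorem exists_seq_contDiffBump {E : Type*} [NormedAddCommGroup E] :
    ∃ ρ : ℕ → ContDiffBump (0 : E), Tendsto (fun k => (ρ k).rOut) atTop (𝓝 0) ∧
      ∀ k, (ρ k).rOut ≤ 1 := by
  refine ⟨fun k => ⟨1 / ((k : ℝ) + 1) / 2, 1 / ((k : ℝ) + 1), by positivity,
    half_lt_self (by positivity)⟩, tendsto_one_div_add_atTop_nhds_zero_nat, fun k => ?_⟩
  exact (div_le_one (by positivity)).2 (by linarith [(k.cast_nonneg : (0 : ℝ) ≤ k)])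

section Mollify

variable {E : Type*} [NormedAddCommGroup E] [NormedSpace ℝ E] [FiniteDimensional ℝ E]
  [MeasurableSpace E] [BorelSpace E] {μ : Measure E}

/-- The mollification `ρ ⋆ f` of a function by a normalized bump function. -/
noncomputable def mollify (μ : Measure E) (ρ : ContDiffBump (0 : E)) (f : E → ℝ) : E → ℝ :=
  convolution (ρ.normed μ) f (ContinuousLinearMap.lsmul ℝ ℝ) μ

/-- The probability measure whose density is the normalized bump function `ρ`. -/
noncomputable def bumpMeasure (μ : Measure E) (ρ : ContDiffBump (0 : E)) : Measure E :=
  μ.withDensity fun y => ENNReal.ofReal (ρ.normed μ y)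

variable (ρ : ContDiffBump (0 : E))

theorem measurable_ofReal_normed : Measurable fun y => ENNReal.ofReal (ρ.normed μ y) :=
  ρ.continuous_normed.measurable.ennreal_ofReal

theorem integral_bumpMeasure (g : E → ℝ) :
    ∫ y, g y ∂(bumpMeasure μ ρ) = ∫ y, ρ.normed μ y * g y ∂μ := by
  rw [bumpMeasure, integral_withDensity_eq_integral_toReal_smul (measurable_ofReal_normed ρ)
    (Eventually.of_forall fun _ => ENNReal.ofReal_lt_top)]
  simp [ENNReal.toReal_ofReal (ρ.nonneg_normed _)]

theorem mollify_eq_integral (f : E → ℝ) (x : E) :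
    mollify μ ρ f x = ∫ y, f (x - y) ∂(bumpMeasure μ ρ) := by
  rw [integral_bumpMeasure]
  rfl

variable [μ.IsAddHaarMeasure] {p : ℝ≥0∞}

/-- Translations act continuously on `L_p`, `p < ∞`. -/
theorem tendsto_eLpNorm_translate_sub {f : E → ℝ} (hp1 : 1 ≤ p) (hp : p ≠ ∞) (hf : MemLp f p μ) :
    Tendsto (fun y => eLpNorm (fun x => f (x - y) - f x) p μ) (𝓝 0) (𝓝 0) := by
  have : Fact (1 ≤ p) := ⟨hp1⟩
  have hmp : ∀ y : E, MeasurePreserving (fun x => x - y) μ μ :=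
    fun y => measurePreserving_sub_right μ y
  let g : E → C(E, E) := fun y => ⟨fun x => x - y, by fun_prop⟩
  have hg : Continuous g := ContinuousMap.continuous_of_continuous_uncurry _ (by
    change Continuous fun z : E × E => z.2 - z.1
    fun_prop)
  have h := (continuous_const (y := hf.toLp f)).compMeasurePreservingLp hg hmp hp
  have h0 := (h.sub (continuous_const (y := hf.toLp f))).enorm.tendsto 0
  have e : ∀ y, eLpNorm (fun x => f (x - y) - f x) p μ =
      ‖Lp.compMeasurePreserving (g y) (hmp y) (hf.toLp f) - hf.toLp f‖ₑ := by
    intro y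
    rw [Lp.enorm_def]
    refine eLpNorm_congr_ae ?_
    have a1 := Lp.coeFn_sub (Lp.compMeasurePreserving (g y) (hmp y) (hf.toLp f)) (hf.toLp f)
    have a2 := Lp.coeFn_compMeasurePreserving (hf.toLp f) (hmp y)
    have a3 := (hmp y).quasiMeasurePreserving.ae_eq_comp hf.coeFn_toLp
    filter_upwards [a1, a2, a3, hf.coeFn_toLp] with x b1 b2 b3 b4
    rw [b1, Pi.sub_apply, b4]
    congr 1
    exact (b2.trans b3).symm
  have e0 : ‖Lp.compMeasurePreserving (g 0) (hmp 0) (hf.toLp f) - hf.toLp f‖ₑ = 0 := by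
    rw [← e 0]
    simp
  have h1 : Tendsto (fun y => ‖Lp.compMeasurePreserving (g y) (hmp y) (hf.toLp f) - hf.toLp f‖ₑ)
      (𝓝 0) (𝓝 ‖Lp.compMeasurePreserving (g 0) (hmp 0) (hf.toLp f) - hf.toLp f‖ₑ) := h0
  rw [e0] at h1
  exact h1.congr fun y => (e y).symm

/-- For a `C¹` function the translation increment is controlled by the directional derivative. -/
theorem eLpNorm_translate_sub_le_fderiv {u : E → ℝ} (hu : ContDiff ℝ 1 u) (hp1 : 1 ≤ p)
    (hp : p ≠ ∞) (y : E) :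
    eLpNorm (fun x => u (x - y) - u x) p μ ≤ eLpNorm (fun x => fderiv ℝ u x y) p μ := by
  have hc : Continuous fun x => fderiv ℝ u x y :=
    (hu.continuous_fderiv one_ne_zero).clm_apply continuous_const
  have : IsProbabilityMeasure ((volume : Measure ℝ).restrict (Set.Ioc 0 1)) := ⟨by simp⟩
  have e : (fun x => u (x - y) - u x) =
      fun x => ∫ t in Set.Ioc (0 : ℝ) 1, -(fderiv ℝ u (x - t • y) y) := by
    ext x
    rw [← intervalIntegral.integral_of_le zero_le_one]
    have hd : ∀ t : ℝ, HasDerivAt (fun t : ℝ => u (x - t • y)) (-(fderiv ℝ u (x - t • y) y)) t := by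
      intro t
      have h1 : HasDerivAt (fun t : ℝ => x - t • y) (-y) t := by
        simpa using ((hasDerivAt_id t).smul_const y).const_sub x
      have h2 := (hu.differentiable one_ne_zero (x - t • y)).hasFDerivAt.comp_hasDerivAt t h1
      rw [map_neg] at h2
      exact h2
    rw [intervalIntegral.integral_eq_sub_of_hasDerivAt (fun t _ => hd t)]
    · simp
    · refine Continuous.intervalIntegrable ?_ _ _
      exact (hc.comp (by fun_prop)).neg
  rw [e]
  refine eLpNorm_integral_le_of_ae_le ?_ hp1 hp (Eventually.of_forall fun t => ?_)
  · refine Continuous.aestronglyMeasurable ?_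
    exact (hc.comp (f := fun z : E × ℝ => z.1 - z.2 • y) (by fun_prop)).neg
  · refine le_of_eq ?_
    have := eLpNorm_neg (fun x => fderiv ℝ u (x - t • y) y) p μ
    refine Eq.trans this ?_
    exact eLpNorm_translate (f := fun x => fderiv ℝ u x y) hc.aestronglyMeasurable (t • y)

instance : IsProbabilityMeasure (bumpMeasure μ ρ) := by
  refine ⟨?_⟩
  rw [bumpMeasure, withDensity_apply _ MeasurableSet.univ, Measure.restrict_univ,
    ← ofReal_integral_eq_lintegral_ofReal ρ.integrable_normed
      (Eventually.of_forall ρ.nonneg_normed), ρ.integral_normed, ENNReal.ofReal_one]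

theorem ae_bumpMeasure_norm_lt : ∀ᵐ y ∂(bumpMeasure μ ρ), ‖y‖ < ρ.rOut := by
  rw [bumpMeasure, ae_withDensity_iff (measurable_ofReal_normed ρ)]
  refine Eventually.of_forall fun y hy => ?_
  have h1 : y ∈ Function.support (ρ.normed μ) := by
    intro h0
    simp [h0] at hy
  rw [ρ.support_normed_eq] at h1
  simpa using h1

theorem contDiff_mollify {f : E → ℝ} (hf : LocallyIntegrable f μ) :
    ContDiff ℝ (⊤ : ℕ∞) (mollify μ ρ f) :=
  ρ.hasCompactSupport_normed.contDiff_convolution_left _ ρ.contDiff_normed hf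

theorem aestronglyMeasurable_comp_sub {κ : Measure E} [SFinite κ] {f : E → ℝ}
    (hf : AEStronglyMeasurable f μ) :
    AEStronglyMeasurable (fun z : E × E => f (z.1 - z.2)) (μ.prod κ) :=
  hf.comp_quasiMeasurePreserving (quasiMeasurePreserving_sub_of_right_invariant μ κ)

theorem eLpNorm_mollify_le {f : E → ℝ} (hp1 : 1 ≤ p) (hp : p ≠ ∞)
    (hf : AEStronglyMeasurable f μ) : eLpNorm (mollify μ ρ f) p μ ≤ eLpNorm f p μ := by
  have e : mollify μ ρ f = fun x => ∫ y, f (x - y) ∂(bumpMeasure μ ρ) :=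
    funext (mollify_eq_integral ρ f)
  rw [e]
  exact eLpNorm_integral_le_of_ae_le (aestronglyMeasurable_comp_sub hf) hp1 hp
    (Eventually.of_forall fun y => (eLpNorm_translate hf y).le)

theorem memLp_mollify {f : E → ℝ} (hp1 : 1 ≤ p) (hp : p ≠ ∞) (hf : MemLp f p μ) :
    MemLp (mollify μ ρ f) p μ :=
  ⟨(contDiff_mollify ρ (hf.locallyIntegrable hp1)).continuous.aestronglyMeasurable,
    (eLpNorm_mollify_le ρ hp1 hp hf.1).trans_lt hf.2⟩

theorem integrable_bumpMeasure_sub {f : E → ℝ} (hf : LocallyIntegrable f μ) (x : E) :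
    Integrable (fun y => f (x - y)) (bumpMeasure μ ρ) := by
  rw [bumpMeasure, integrable_withDensity_iff_integrable_smul' (measurable_ofReal_normed ρ)
    (Eventually.of_forall fun _ => ENNReal.ofReal_lt_top)]
  have h := ρ.hasCompactSupport_normed.convolutionExists_left (ContinuousLinearMap.lsmul ℝ ℝ)
    (ρ.continuous_normed (μ := μ)) hf x
  refine h.congr (Eventually.of_forall fun y => ?_)
  simp [ENNReal.toReal_ofReal (ρ.nonneg_normed _)]

theorem eLpNorm_mollify_sub_le {f : E → ℝ} (hp1 : 1 ≤ p) (hp : p ≠ ∞) (hf : MemLp f p μ)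
    {C : ℝ≥0∞} (hC : ∀ y, ‖y‖ < ρ.rOut → eLpNorm (fun x => f (x - y) - f x) p μ ≤ C) :
    eLpNorm (mollify μ ρ f - f) p μ ≤ C := by
  have e : mollify μ ρ f - f = fun x => ∫ y, (f (x - y) - f x) ∂(bumpMeasure μ ρ) := by
    ext x
    rw [integral_sub (integrable_bumpMeasure_sub ρ (hf.locallyIntegrable hp1) x)
      (integrable_const _), ← mollify_eq_integral]
    simp
  rw [e]
  refine eLpNorm_integral_le_of_ae_le ?_ hp1 hp ?_
  · exact (aestronglyMeasurable_comp_sub hf.1).sub hf.1.comp_fst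
  · filter_upwards [ae_bumpMeasure_norm_lt ρ] with y hy using hC y hy

theorem tendstoInLp_mollify {f : E → ℝ} (hp1 : 1 ≤ p) (hp : p ≠ ∞) (hf : MemLp f p μ)
    {ι : Type*} {l : Filter ι} {ρ : ι → ContDiffBump (0 : E)}
    (hρ : Tendsto (fun i => (ρ i).rOut) l (𝓝 0)) :
    TendstoInLp p μ l (fun i => mollify μ (ρ i) f) f := by
  refine ⟨fun i => memLp_mollify (ρ i) hp1 hp hf, hf, ENNReal.tendsto_nhds_zero.2 fun ε hε => ?_⟩
  have h := ENNReal.tendsto_nhds_zero.1 (tendsto_eLpNorm_translate_sub hp1 hp hf) ε hε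
  obtain ⟨δ, hδ, hb⟩ := Metric.eventually_nhds_iff.1 h
  filter_upwards [hρ.eventually (gt_mem_nhds hδ)] with i hi
  exact eLpNorm_mollify_sub_le (ρ i) hp1 hp hf fun y hy => hb (by simpa using hy.trans hi)

end Mollify

/-! ### The integral of a Jacobian minor of smooth functions -/

section NullLagrangian

variable {E : Type*} [NormedAddCommGroup E] [NormedSpace ℝ E]

/-- A signed sum over permutations vanishes if the summand is invariant under composition with a
transposition `(0 l)`. -/
theorem sum_perm_sign_mul_eq_zero {m : ℕ} (l : Fin m)
    (T : Equiv.Perm (Fin (m + 1)) → ℝ) (hT : ∀ σ, T (σ * Equiv.swap 0 l.succ) = T σ) :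
    ∑ σ : Equiv.Perm (Fin (m + 1)), ((Equiv.Perm.sign σ : ℤ) : ℝ) * T σ = 0 := by
  have h0 : (0 : Fin (m + 1)) ≠ l.succ := (Fin.succ_ne_zero l).symm
  refine Finset.sum_involution (fun σ _ => σ * Equiv.swap 0 l.succ) ?_ ?_ ?_ ?_
  · intro σ _
    rw [hT, Equiv.Perm.sign_mul, Equiv.Perm.sign_swap h0]
    push_cast
    ring
  · intro σ _ _ h
    have : Equiv.swap 0 l.succ = 1 := mul_left_cancel (a := σ) (by simpa using h)
    exact h0 (Equiv.swap_eq_one_iff.1 this)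
  · intros
    exact Finset.mem_univ _
  · intro σ _
    simp [mul_assoc]

variable [MeasurableSpace E] [BorelSpace E] [FiniteDimensional ℝ E] {μ : Measure E}
  [μ.IsAddHaarMeasure]

/-- A Jacobian determinant of smooth functions, one of which has compact support, has integral
zero. Integrating by parts in each term of the Leibniz expansion leaves second derivatives, which
cancel in pairs: composing a permutation with a transposition `(0 l)` changes its sign, and the
second derivatives are symmetric. -/
theorem integral_det_fderiv_eq_zero {m : ℕ} {h : Fin (m + 1) → E → ℝ}
    (hh : ∀ i, ContDiff ℝ (⊤ : ℕ∞) (h i)) (h0 : HasCompactSupport (h 0)) (v : Fin (m + 1) → E) :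
    ∫ x, (Matrix.of fun i j => fderiv ℝ (h i) x (v j)).det ∂μ = 0 := by
  let P : Equiv.Perm (Fin (m + 1)) → E → ℝ := fun σ x =>
    ∏ i : Fin m, fderiv ℝ (h i.succ) x (v (σ i.succ))
  have hD : ∀ i w, ContDiff ℝ (⊤ : ℕ∞) fun x => fderiv ℝ (h i) x w := fun i w =>
    ((hh i).fderiv_right (m := (⊤ : ℕ∞)) (by simp)).clm_apply contDiff_const
  have hP : ∀ σ, ContDiff ℝ (⊤ : ℕ∞) (P σ) := fun σ => contDiff_prod fun i _ => hD _ _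
  have hdet : ∀ x, (Matrix.of fun i j => fderiv ℝ (h i) x (v j)).det =
      ∑ σ : Equiv.Perm (Fin (m + 1)),
        ((Equiv.Perm.sign σ : ℤ) : ℝ) * (fderiv ℝ (h 0) x (v (σ 0)) * P σ x) := by
    intro x
    rw [← Matrix.det_transpose, Matrix.det_apply']
    refine Finset.sum_congr rfl fun σ _ => ?_
    rw [Fin.prod_univ_succ]
    rfl
  have hcs : ∀ w, HasCompactSupport fun x => fderiv ℝ (h 0) x w := fun w => h0.fderiv_apply ℝ w
  have hi1 : ∀ σ : Equiv.Perm (Fin (m + 1)),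
      Integrable (fun x => fderiv ℝ (h 0) x (v (σ 0)) * P σ x) μ := fun σ =>
    ((hD _ _).continuous.mul (hP σ).continuous).integrable_of_hasCompactSupport (hcs _).mul_right
  have hi2 : ∀ σ : Equiv.Perm (Fin (m + 1)),
      Integrable (fun x => h 0 x * fderiv ℝ (P σ) x (v (σ 0))) μ := fun σ =>
    ((hh 0).continuous.mul (((hP σ).continuous_fderiv (by simp)).clm_apply
      continuous_const)).integrable_of_hasCompactSupport h0.mul_right
  have hi3 : ∀ σ : Equiv.Perm (Fin (m + 1)), Integrable (fun x => h 0 x * P σ x) μ := fun σ =>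
    ((hh 0).continuous.mul (hP σ).continuous).integrable_of_hasCompactSupport h0.mul_right
  have hparts : ∀ σ : Equiv.Perm (Fin (m + 1)), ∫ x, fderiv ℝ (h 0) x (v (σ 0)) * P σ x ∂μ =
      -∫ x, h 0 x * fderiv ℝ (P σ) x (v (σ 0)) ∂μ := by
    intro σ
    rw [integral_mul_fderiv_eq_neg_fderiv_mul_of_integrable (hi1 σ) (hi2 σ) (hi3 σ)
      (fun x _ => (hh 0).differentiable (by simp) x) fun x _ => (hP σ).differentiable (by simp) x,
      neg_neg]
  have hcancel : ∀ x, ∑ σ : Equiv.Perm (Fin (m + 1)),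
      ((Equiv.Perm.sign σ : ℤ) : ℝ) * fderiv ℝ (P σ) x (v (σ 0)) = 0 := by
    intro x
    have hfd : ∀ σ, fderiv ℝ (P σ) x (v (σ 0)) = ∑ l : Fin m,
        (∏ i ∈ Finset.univ.erase l, fderiv ℝ (h i.succ) x (v (σ i.succ))) *
          fderiv ℝ (fderiv ℝ (h l.succ)) x (v (σ 0)) (v (σ l.succ)) := by
      intro σ
      have hd : ∀ i ∈ (Finset.univ : Finset (Fin m)),
          HasFDerivAt (fun y => fderiv ℝ (h i.succ) y (v (σ i.succ)))
            ((fderiv ℝ (fderiv ℝ (h i.succ)) x).flip (v (σ i.succ))) x := by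
        intro i _
        have h1 : HasFDerivAt (fderiv ℝ (h i.succ)) (fderiv ℝ (fderiv ℝ (h i.succ)) x) x :=
          (((hh i.succ).fderiv_right (m := 1) (by norm_cast)).differentiable
            one_ne_zero x).hasFDerivAt
        simpa using h1.clm_apply (hasFDerivAt_const (v (σ i.succ)) x)
      have h2 := (HasFDerivAt.finsetProd hd).fderiv
      change fderiv ℝ (fun y => ∏ i : Fin m, fderiv ℝ (h i.succ) y (v (σ i.succ))) x _ = _
      rw [h2]
      simp
    simp_rw [hfd, Finset.mul_sum]
    rw [Finset.sum_comm]
    refine Finset.sum_eq_zero fun l _ => sum_perm_sign_mul_eq_zero l (fun σ =>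
        (∏ i ∈ Finset.univ.erase l, fderiv ℝ (h i.succ) x (v (σ i.succ))) *
          fderiv ℝ (fderiv ℝ (h l.succ)) x (v (σ 0)) (v (σ l.succ))) fun σ => ?_
    have hsymm : IsSymmSndFDerivAt ℝ (h l.succ) x :=
      (hh l.succ).contDiffAt.isSymmSndFDerivAt (by
        rw [minSmoothness_of_isRCLikeNormedField]
        exact WithTop.coe_le_coe.2 (le_top : (2 : ℕ∞) ≤ ⊤))
    congr 1
    · refine Finset.prod_congr rfl fun i hi => ?_
      have hil : i.succ ≠ l.succ := fun e => Finset.ne_of_mem_erase hi (Fin.succ_injective _ e)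
      rw [Equiv.Perm.mul_apply, Equiv.swap_apply_of_ne_of_ne (Fin.succ_ne_zero i) hil]
    · rw [Equiv.Perm.mul_apply, Equiv.Perm.mul_apply, Equiv.swap_apply_left,
        Equiv.swap_apply_right]
      exact hsymm _ _
  simp_rw [hdet]
  rw [integral_finsetSum _ fun σ _ => (hi1 σ).const_mul _]
  simp_rw [integral_const_mul, hparts, mul_neg, ← integral_const_mul]
  rw [Finset.sum_neg_distrib, ← integral_finsetSum _ fun σ _ => (hi2 σ).const_mul _, neg_eq_zero]
  refine integral_eq_zero_of_ae (Eventually.of_forall fun x => ?_)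
  have e : ∀ σ : Equiv.Perm (Fin (m + 1)),
      ((Equiv.Perm.sign σ : ℤ) : ℝ) * (h 0 x * fderiv ℝ (P σ) x (v (σ 0))) =
        h 0 x * (((Equiv.Perm.sign σ : ℤ) : ℝ) * fderiv ℝ (P σ) x (v (σ 0))) := fun σ => by ring
  simp only [e, ← Finset.mul_sum, hcancel x, mul_zero, Pi.zero_apply]

end NullLagrangian

/-! ### Weak directional derivatives on the whole space -/

section WeakLineDeriv

variable {E : Type*} [NormedAddCommGroup E] [NormedSpace ℝ E] [MeasurableSpace E]

/-- `G` is the weak derivative of the scalar function `g` on the whole space in the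
direction `v`. -/
def HasWeakLineDeriv (μ : Measure E) (g G : E → ℝ) (v : E) : Prop :=
  ∀ θ : E → ℝ, ContDiff ℝ (⊤ : ℕ∞) θ → HasCompactSupport θ →
    ∫ x, fderiv ℝ θ x v * g x ∂μ = -∫ x, θ x * G x ∂μ

variable [BorelSpace E] [FiniteDimensional ℝ E] {μ : Measure E}
  [μ.IsAddHaarMeasure] {p : ℝ≥0∞} {g G : E → ℝ} {v : E}

/-- Mollification commutes with weak derivatives. -/
theorem HasWeakLineDeriv.fderiv_mollify (h : HasWeakLineDeriv μ g G v)
    (hg : LocallyIntegrable g μ) (ρ : ContDiffBump (0 : E)) (x : E) :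
    fderiv ℝ (mollify μ ρ g) x v = mollify μ ρ G x := by
  let r : E → ℝ := ρ.normed μ
  have hr : ContDiff ℝ (⊤ : ℕ∞) r := ρ.contDiff_normed
  have hrc : HasCompactSupport r := ρ.hasCompactSupport_normed
  have hr1 : ContDiff ℝ 1 r := hr.of_le (by norm_cast)
  have hd := hrc.hasFDerivAt_convolution_left (ContinuousLinearMap.lsmul ℝ ℝ) hr1 hg x
  have hd' : fderiv ℝ (mollify μ ρ g) x = convolution (fderiv ℝ r) g
      ((ContinuousLinearMap.lsmul ℝ ℝ).precompL E) μ x := hd.fderiv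
  have hex : ConvolutionExistsAt (fderiv ℝ r) g x
      ((ContinuousLinearMap.lsmul ℝ ℝ).precompL E) μ :=
    (hrc.fderiv (𝕜 := ℝ)).convolutionExists_left _ (hr.continuous_fderiv (by simp)) hg x
  have e1 : fderiv ℝ (mollify μ ρ g) x v = ∫ t, fderiv ℝ r t v * g (x - t) ∂μ := by
    rw [hd', convolution, ContinuousLinearMap.integral_apply hex]
    rfl
  -- the reflected kernel `t ↦ r (x - t)` serves as the test function
  let θ : E → ℝ := fun t => r (x - t)
  have hθ : ContDiff ℝ (⊤ : ℕ∞) θ := hr.comp (contDiff_const.sub contDiff_id)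
  have hθc : HasCompactSupport θ := hrc.comp_homeomorph (Homeomorph.subLeft x)
  have hfd : ∀ t, fderiv ℝ θ t v = -fderiv ℝ r (x - t) v := by
    intro t
    have h1 : HasFDerivAt (fun t : E => x - t) (-ContinuousLinearMap.id ℝ E) t :=
      (hasFDerivAt_id t).const_sub x
    have h2 := ((hr.differentiable (by simp) (x - t)).hasFDerivAt.comp t h1).fderiv
    change fderiv ℝ (r ∘ fun t => x - t) t v = _
    rw [h2]
    simp
  have h3 := h θ hθ hθc
  rw [e1, ← integral_sub_left_eq_self _ μ x]
  simp only [sub_sub_cancel]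
  simp_rw [hfd, neg_mul] at h3
  rw [integral_neg, neg_inj] at h3
  rw [h3]
  change _ = ∫ t, r t * G (x - t) ∂μ
  rw [← integral_sub_left_eq_self _ μ x]
  simp only [sub_sub_cancel, θ]

/-- The `L_p` modulus of continuity of a Sobolev function. -/
theorem HasWeakLineDeriv.eLpNorm_translate_sub_le (h : HasWeakLineDeriv μ g G v) (hp1 : 1 ≤ p)
    (hp : p ≠ ∞) (hg : MemLp g p μ) (hG : AEStronglyMeasurable G μ) :
    eLpNorm (fun x => g (x - v) - g x) p μ ≤ eLpNorm G p μ := by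
  obtain ⟨ρ, hρ, -⟩ := exists_seq_contDiffBump (E := E)
  let u : ℕ → E → ℝ := fun k => mollify μ (ρ k) g
  have hu : TendstoInLp p μ atTop u g := tendstoInLp_mollify hp1 hp hg hρ
  have hloc := hg.locallyIntegrable hp1
  have key : ∀ k, eLpNorm (fun x => g (x - v) - g x) p μ ≤
      eLpNorm (u k - g) p μ + eLpNorm G p μ + eLpNorm (u k - g) p μ := by
    intro k
    have hmp := measurePreserving_sub_right μ v
    have m1 : AEStronglyMeasurable (u k - g) μ := ((hu.1 k).sub hg).1
    have m1' : AEStronglyMeasurable (fun x => (u k - g) (x - v)) μ :=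
      m1.comp_measurePreserving hmp
    have m2 : AEStronglyMeasurable (fun x => u k (x - v) - u k x) μ :=
      ((hu.1 k).1.comp_measurePreserving hmp).sub (hu.1 k).1
    have e : (fun x => g (x - v) - g x) =
        (-fun x => (u k - g) (x - v)) + (fun x => u k (x - v) - u k x) + (u k - g) := by
      ext x
      simp
    rw [e]
    refine (eLpNorm_add_le (m1'.neg.add m2) m1 hp1).trans (add_le_add
      ((eLpNorm_add_le m1'.neg m2 hp1).trans (add_le_add ?_ ?_)) le_rfl)
    · rw [eLpNorm_neg]
      exact (eLpNorm_translate m1 v).le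
    · refine (eLpNorm_translate_sub_le_fderiv ((contDiff_mollify (ρ k) hloc).of_le
        (by norm_cast)) hp1 hp v).trans ?_
      simp_rw [h.fderiv_mollify hloc]
      exact eLpNorm_mollify_le (ρ k) hp1 hp hG
  refine ge_of_tendsto' (x := atTop) ?_ key
  simpa using (hu.2.2.add_const (eLpNorm G p μ)).add hu.2.2

theorem mollify_eq_zero_of_notMem_cthickening {f : E → ℝ} {K : Set E} (hf : ∀ x ∉ K, f x = 0)
    (ρ : ContDiffBump (0 : E)) {δ : ℝ} (hρ : ρ.rOut ≤ δ) {x : E}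
    (hx : x ∉ Metric.cthickening δ K) : mollify μ ρ f x = 0 := by
  rw [mollify_eq_integral]
  refine integral_eq_zero_of_ae ?_
  filter_upwards [ae_bumpMeasure_norm_lt (μ := μ) ρ] with y hy
  refine hf _ fun hK => hx ?_
  refine Metric.mem_cthickening_of_dist_le x (x - y) δ K hK ?_
  simpa using (hy.le.trans hρ)

/-- The Jacobian determinant of Sobolev functions, one of which has compact support, has integral
zero. -/
theorem integral_det_eq_zero_of_hasWeakLineDeriv {n m : ℕ} (hmn : m + 1 ≤ n)
    {g : Fin (m + 1) → E → ℝ} {G : Fin (m + 1) → Fin (m + 1) → E → ℝ} {v : Fin (m + 1) → E}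
    (hg : ∀ i, MemLp (g i) n μ) (hG : ∀ i j, MemLp (G i j) n μ)
    (h : ∀ i j, HasWeakLineDeriv μ (g i) (G i j) (v j)) {K : Set E} (hK : IsCompact K)
    (hg0 : ∀ x ∉ K, g 0 x = 0) (hG0 : ∀ j, ∀ x ∉ K, G 0 j x = 0) :
    ∫ x, (Matrix.of fun i j => G i j x).det ∂μ = 0 := by
  have hn : n ≠ 0 := by omega
  have hp1 : (1 : ℝ≥0∞) ≤ n := by exact_mod_cast Nat.one_le_iff_ne_zero.2 hn
  have hp : (n : ℝ≥0∞) ≠ ∞ := ENNReal.natCast_ne_top n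
  obtain ⟨ρ, hρ, hρ1⟩ := exists_seq_contDiffBump (E := E)
  have hloc : ∀ i, LocallyIntegrable (g i) μ := fun i => (hg i).locallyIntegrable hp1
  have hK1 : IsCompact (Metric.cthickening 1 K) := hK.cthickening
  have hKK : K ⊆ Metric.cthickening 1 K := Metric.self_subset_cthickening K
  have hdet : TendstoInLp ((n : ℝ≥0∞) / ((m + 1 : ℕ) : ℝ≥0∞)) μ atTop
      (fun k x => (Matrix.of fun i j => mollify μ (ρ k) (G i j) x).det)
      (fun x => (Matrix.of fun i j => G i j x).det) :=
    TendstoInLp.det hn hmn fun i j => tendstoInLp_mollify hp1 hp (hG i j) hρ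
  have hrow : ∀ {A : Matrix (Fin (m + 1)) (Fin (m + 1)) ℝ}, (∀ j, A 0 j = 0) → A.det = 0 :=
    fun hA => Matrix.det_eq_zero_of_row_eq_zero 0 hA
  have h1 := (hdet.mono_exponent_of_eq_zero hK1.measurableSet hK1.measure_lt_top.ne
    (one_le_natCast_div hn hmn)
    (fun k x hx => hrow fun j =>
      mollify_eq_zero_of_notMem_cthickening (hG0 j) (ρ k) (hρ1 k) hx)
    (fun x hx => hrow fun j => hG0 j x fun hxK => hx (hKK hxK))).tendsto_integral
  have h2 : ∀ k, ∫ x, (Matrix.of fun i j => mollify μ (ρ k) (G i j) x).det ∂μ = 0 := by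
    intro k
    have hc : HasCompactSupport (mollify μ (ρ k) (g 0)) := HasCompactSupport.intro hK1 fun x hx =>
      mollify_eq_zero_of_notMem_cthickening hg0 (ρ k) (hρ1 k) hx
    have h3 := integral_det_fderiv_eq_zero (μ := μ) (h := fun i => mollify μ (ρ k) (g i))
      (fun i => contDiff_mollify (ρ k) (hloc i)) hc v
    simp_rw [(h _ _).fderiv_mollify (hloc _)] at h3
    exact h3
  simp_rw [h2] at h1
  exact (tendsto_nhds_unique tendsto_const_nhds h1).symm

end WeakLineDeriv

/-! ### Consequences of weak convergence -/

section WeakConvergence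

variable {V : Type*} [NormedAddCommGroup V] [NormedSpace ℝ V]

theorem WeaklyConverges.tendsto_apply {v : ℕ → V} {v₀ : V} (h : WeaklyConverges v v₀)
    (ℓ : V →L[ℝ] ℝ) : Tendsto (fun k => ℓ (v k)) atTop (𝓝 (ℓ v₀)) :=
  ((WeakBilin.eval_continuous (topDualPairing ℝ V).flip ℓ).tendsto (toWeakSpace ℝ V v₀)).comp h

/-- Weakly convergent sequences are bounded, by the uniform boundedness principle. -/
theorem WeaklyConverges.exists_norm_le {v : ℕ → V} {v₀ : V} (h : WeaklyConverges v v₀) :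
    ∃ C, ∀ k, ‖v k‖ ≤ C := by
  obtain ⟨C, hC⟩ := banach_steinhaus (g := fun k => NormedSpace.inclusionInDoubleDual ℝ V (v k))
    fun ℓ => by
      obtain ⟨C, hC⟩ := (h.tendsto_apply ℓ).norm.bddAbove_range
      exact ⟨C, fun k => hC ⟨k, rfl⟩⟩
  exact ⟨C, fun k => ((NormedSpace.inclusionInDoubleDualLi ℝ (E := V)).norm_map (v k)).symm.trans_le
    (hC k)⟩

theorem WeaklyConverges.map {W : Type*} [NormedAddCommGroup W] [NormedSpace ℝ W] {v : ℕ → V}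
    {v₀ : V} (h : WeaklyConverges v v₀) (T : V →L[ℝ] W) :
    WeaklyConverges (fun k => T (v k)) (T v₀) :=
  ((WeakSpace.map T).continuous.tendsto (toWeakSpace ℝ V v₀)).comp h

variable {α F : Type*} {mα : MeasurableSpace α} {μ : Measure α} [NormedAddCommGroup F]
  [NormedSpace ℝ F] {p s : ℝ≥0∞}

theorem enorm_integral_mul_le [s.HolderConjugate p] {u v : α → ℝ} (hu : AEStronglyMeasurable u μ)
    (hv : AEStronglyMeasurable v μ) :
    ‖∫ x, u x * v x ∂μ‖ₑ ≤ eLpNorm u s μ * eLpNorm v p μ := by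
  refine (enorm_integral_le_lintegral_enorm _).trans ?_
  rw [← eLpNorm_one_eq_lintegral_enorm]
  exact eLpNorm_smul_le_mul_eLpNorm (φ := u) (f := v) hv hu

variable [Fact (1 ≤ p)]

theorem WeaklyConverges.tendsto_integral [s.HolderConjugate p] {f : ℕ → Lp F p μ} {f₀ : Lp F p μ}
    (h : WeaklyConverges f f₀) {a : α → ℝ} (ha : MemLp a s μ) (L : F →L[ℝ] ℝ) :
    Tendsto (fun k => ∫ x, a x * L (f k x) ∂μ) atTop (𝓝 (∫ x, a x * L (f₀ x) ∂μ)) := by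
  have : Fact (1 ≤ s) := ⟨ENNReal.HolderConjugate.one_le s p⟩
  have hA : MemLp (fun x => a x • L) s μ := (ContinuousLinearMap.toSpanSingleton ℝ L).comp_memLp' ha
  have key : ∀ g : Lp F p μ, ContinuousLinearMap.lpPairing μ s p (ContinuousLinearMap.id ℝ _)
      hA.toLp g = ∫ x, a x * L (g x) ∂μ := by
    intro g
    rw [ContinuousLinearMap.lpPairing_eq_integral]
    refine integral_congr_ae ?_
    filter_upwards [hA.coeFn_toLp] with x hx
    rw [hx]
    simp
  simp_rw [← key]
  exact h.tendsto_apply _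

/-- The pairing of a norm convergent sequence with a weakly convergent one converges. -/
theorem WeaklyConverges.tendsto_integral_mul [s.HolderConjugate p] {f : ℕ → Lp ℝ p μ}
    {f₀ : Lp ℝ p μ} (h : WeaklyConverges f f₀) {a : ℕ → α → ℝ} {a₀ : α → ℝ}
    (ha : TendstoInLp s μ atTop a a₀) :
    Tendsto (fun k => ∫ x, a k x * f k x ∂μ) atTop (𝓝 (∫ x, a₀ x * f₀ x ∂μ)) := by
  obtain ⟨C, hC⟩ := h.exists_norm_le
  have hint : ∀ {b : α → ℝ}, MemLp b s μ → ∀ g : Lp ℝ p μ,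
      Integrable (fun x => b x * g x) μ := fun hb g => by
    rw [← memLp_one_iff_integrable]
    exact (Lp.memLp g).mul hb
  have e : ∀ k, ∫ x, a k x * f k x ∂μ =
      (∫ x, ((a k - a₀) x) * f k x ∂μ) + ∫ x, a₀ x * f k x ∂μ := by
    intro k
    rw [← integral_add (hint ((ha.1 k).sub ha.2.1) _) (hint ha.2.1 _)]
    refine integral_congr_ae (Eventually.of_forall fun x => ?_)
    simp [sub_mul]
  simp_rw [e]
  have h2 := h.tendsto_integral ha.2.1 (ContinuousLinearMap.id ℝ ℝ)
  simp only [ContinuousLinearMap.id_apply] at h2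
  rw [← zero_add (∫ x, a₀ x * f₀ x ∂μ)]
  refine Tendsto.add ?_ h2
  rw [tendsto_zero_iff_enorm_tendsto_zero]
  have h3 := ENNReal.Tendsto.mul_const (b := ENNReal.ofReal C) ha.2.2
    (Or.inr ENNReal.ofReal_ne_top)
  rw [zero_mul] at h3
  refine tendsto_of_tendsto_of_tendsto_of_le_of_le tendsto_const_nhds h3
    (fun _ => zero_le) fun k => ?_
  refine (enorm_integral_mul_le (s := s) (p := p) ((ha.1 k).sub ha.2.1).1
    (Lp.memLp (f k)).1).trans ?_
  gcongr
  rw [← Lp.enorm_def, ← ofReal_norm]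
  exact ENNReal.ofReal_le_ofReal (hC k)

end WeakConvergence

/-! ### Localization of Sobolev maps -/

namespace Sobolev

variable {n : ℕ} {Ω : Opens (Euc n)} {s : ℝ≥0∞} [Fact (1 ≤ s)]

/-- The product `χ φ_i` of a test function and a component of a Sobolev map. It vanishes
outside `Ω`. -/
noncomputable def cut (χ : 𝓓(Ω, ℝ)) (φ : Sobolev Ω s) (i : Fin n) (x : Euc n) : ℝ :=
  χ x * φ.1.1 x i

/-- The derivative `χ ∂_v φ_i + ∂_v χ φ_i` of `χ φ_i` in the direction `v`. -/
noncomputable def cutDeriv (χ : 𝓓(Ω, ℝ)) (φ : Sobolev Ω s) (i : Fin n) (v x : Euc n) : ℝ :=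
  χ x * Sobolev.deriv φ x v i + fderiv ℝ χ x v * φ.1.1 x i

/-- The derivative of a test function in the direction `v`, as a test function. -/
noncomputable def testDeriv (χ : 𝓓(Ω, ℝ)) (v : Euc n) : 𝓓(Ω, ℝ) where
  toFun x := fderiv ℝ χ x v
  contDiff' := (χ.contDiff.fderiv_right (m := (⊤ : ℕ∞)) (by simp)).clm_apply contDiff_const
  hasCompactSupport' := χ.hasCompactSupport.fderiv_apply ℝ v
  tsupport_subset' := (tsupport_fderiv_apply_subset ℝ v).trans χ.tsupport_subset

@[simp]
theorem testDeriv_apply (χ : 𝓓(Ω, ℝ)) (v x : Euc n) : testDeriv χ v x = fderiv ℝ χ x v := rfl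

theorem eq_zero_of_notMem (χ : 𝓓(Ω, ℝ)) {x : Euc n} (hx : x ∉ (Ω : Set (Euc n))) : χ x = 0 :=
  image_eq_zero_of_notMem_tsupport fun h => hx (χ.tsupport_subset h)

theorem eLpNorm_testFunction_mul_le (χ : 𝓓(Ω, ℝ)) {p : ℝ≥0∞} {f : Euc n → ℝ}
    (hf : AEStronglyMeasurable f (volume.restrict (Ω : Set (Euc n)))) :
    eLpNorm (fun x => χ x * f x) p volume ≤
      eLpNorm χ ∞ (volume.restrict (Ω : Set (Euc n))) *
        eLpNorm f p (volume.restrict (Ω : Set (Euc n))) := by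
  have e : (Ω : Set (Euc n)).indicator (fun x => χ x * f x) = fun x => χ x * f x :=
    Set.indicator_eq_self.2 fun x hx => by_contra fun h => hx (by simp [eq_zero_of_notMem χ h])
  rw [← e, eLpNorm_indicator_eq_eLpNorm_restrict Ω.isOpen.measurableSet]
  exact eLpNorm_smul_le_mul_eLpNorm (φ := χ) (f := f) hf χ.continuous.aestronglyMeasurable

theorem memLp_testFunction_mul (χ : 𝓓(Ω, ℝ)) {p : ℝ≥0∞} {f : Euc n → ℝ}
    (hf : MemLp f p (volume.restrict (Ω : Set (Euc n)))) :
    MemLp (fun x => χ x * f x) p volume := by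
  have e : (Ω : Set (Euc n)).indicator (fun x => χ x * f x) = fun x => χ x * f x :=
    Set.indicator_eq_self.2 fun x hx => by_contra fun h => hx (by simp [eq_zero_of_notMem χ h])
  rw [← e, memLp_indicator_iff_restrict Ω.isOpen.measurableSet]
  exact hf.mul (χ.continuous.memLp_top_of_hasCompactSupport χ.hasCompactSupport _)

theorem integral_testFunction_mul (χ : 𝓓(Ω, ℝ)) (f : Euc n → ℝ) :
    ∫ x in (Ω : Set (Euc n)), χ x * f x = ∫ x, χ x * f x :=
  setIntegral_eq_integral_of_forall_compl_eq_zero fun x hx => by simp [eq_zero_of_notMem χ hx]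

theorem memLp_apply (φ : Sobolev Ω s) (i : Fin n) :
    MemLp (fun x => φ.1.1 x i) s (volume.restrict (Ω : Set (Euc n))) :=
  (EuclideanSpace.proj (𝕜 := ℝ) i).comp_memLp' (Lp.memLp φ.1.1)

theorem memLp_deriv_apply (φ : Sobolev Ω s) (v : Euc n) (i : Fin n) :
    MemLp (fun x => Sobolev.deriv φ x v i) s (volume.restrict (Ω : Set (Euc n))) :=
  ((EuclideanSpace.proj (𝕜 := ℝ) i).comp (ContinuousLinearMap.apply ℝ (Euc n) v)).comp_memLp'
    (Lp.memLp φ.1.2)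

theorem cutDeriv_eq_zero_of_notMem_tsupport (χ : 𝓓(Ω, ℝ)) (φ : Sobolev Ω s) (i : Fin n)
    (v : Euc n) {x : Euc n} (hx : x ∉ tsupport χ) : cutDeriv χ φ i v x = 0 := by
  have h : fderiv ℝ χ x = 0 :=
    image_eq_zero_of_notMem_tsupport fun h => hx (tsupport_fderiv_subset ℝ h)
  simp [cutDeriv, image_eq_zero_of_notMem_tsupport hx, h]

theorem memLp_cut (χ : 𝓓(Ω, ℝ)) (φ : Sobolev Ω s) (i : Fin n) : MemLp (cut χ φ i) s volume :=
  memLp_testFunction_mul χ (memLp_apply φ i)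

theorem memLp_cutDeriv (χ : 𝓓(Ω, ℝ)) (φ : Sobolev Ω s) (i : Fin n) (v : Euc n) :
    MemLp (cutDeriv χ φ i v) s volume :=
  (memLp_testFunction_mul χ (memLp_deriv_apply φ v i)).add
    (memLp_testFunction_mul (testDeriv χ v) (memLp_apply φ i))

theorem integral_fderiv_mul_apply (φ : Sobolev Ω s) (θ : 𝓓(Ω, ℝ)) (v : Euc n) (i : Fin n) :
    ∫ x in (Ω : Set (Euc n)), fderiv ℝ θ x v * φ.1.1 x i =
      -∫ x in (Ω : Set (Euc n)), θ x * Sobolev.deriv φ x v i := by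
  have h := congrArg (EuclideanSpace.proj (𝕜 := ℝ) i) (φ.2 θ v)
  rw [map_neg, ← ContinuousLinearMap.integral_comp_comm _
      (testFunction_fderiv_smul_integrable θ v φ.1.1), ← ContinuousLinearMap.integral_comp_comm _
      (testFunction_smul_apply_integrable θ v φ.1.2)] at h
  simpa [Sobolev.deriv] using h

theorem hasWeakLineDeriv_cut (χ : 𝓓(Ω, ℝ)) (φ : Sobolev Ω s) (i : Fin n) (v : Euc n) :
    HasWeakLineDeriv volume (cut χ φ i) (cutDeriv χ φ i v) v := by
  intro θ hθ hθc
  let η : 𝓓(Ω, ℝ) := ⟨fun x => θ x * χ x, hθ.mul χ.contDiff, χ.hasCompactSupport.mul_left,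
    (tsupport_mul_subset_right).trans χ.tsupport_subset⟩
  have hs : (1 : ℝ≥0∞) ≤ s := Fact.out
  have hη : ∀ x, fderiv ℝ η x v = θ x * fderiv ℝ χ x v + fderiv ℝ θ x v * χ x := by
    intro x
    have h1 := (hθ.differentiable (by simp) x).hasFDerivAt.mul
      (χ.contDiff.differentiable (by simp) x).hasFDerivAt
    change fderiv ℝ (fun x => θ x * χ x) x v = _
    refine (congrArg (fun A => A v) h1.fderiv).trans ?_
    simp [mul_comm]
  have key := integral_fderiv_mul_apply φ η v i
  have k1 : ∫ x in (Ω : Set (Euc n)), fderiv ℝ η x v * φ.1.1 x i =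
      ∫ x, fderiv ℝ η x v * φ.1.1 x i := integral_testFunction_mul (testDeriv η v) _
  rw [k1, integral_testFunction_mul η] at key
  have int : ∀ {f : Euc n → ℝ}, MemLp f s volume → ∀ {t : Euc n → ℝ}, Continuous t →
      HasCompactSupport t → Integrable (fun x => t x * f x) volume := fun hf _ ht htc =>
    (hf.locallyIntegrable hs).integrable_smul_left_of_hasCompactSupport ht htc
  have i1 := int (memLp_testFunction_mul χ (memLp_deriv_apply φ v i)) hθ.continuous hθc
  have i2 := int (memLp_testFunction_mul (testDeriv χ v) (memLp_apply φ i)) hθ.continuous hθc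
  have i3 := int (memLp_cut χ φ i) ((hθ.continuous_fderiv (by simp)).clm_apply continuous_const)
    (hθc.fderiv_apply ℝ v)
  have e1 : ∫ x, fderiv ℝ η x v * φ.1.1 x i =
      (∫ x, θ x * (testDeriv χ v x * φ.1.1 x i)) + ∫ x, fderiv ℝ θ x v * cut χ φ i x := by
    rw [← integral_add i2 i3]
    refine integral_congr_ae (Eventually.of_forall fun x => ?_)
    simp only [hη, cut, testDeriv_apply]
    ring
  have e2 : ∫ x, θ x * cutDeriv χ φ i v x = (∫ x, η x * Sobolev.deriv φ x v i) +
      ∫ x, θ x * (testDeriv χ v x * φ.1.1 x i) := by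
    have : ∀ x, η x * Sobolev.deriv φ x v i = θ x * (χ x * Sobolev.deriv φ x v i) :=
      fun x => mul_assoc _ _ _
    simp_rw [this]
    rw [← integral_add i1 i2]
    refine integral_congr_ae (Eventually.of_forall fun x => ?_)
    simp only [cutDeriv, testDeriv_apply]
    ring
  rw [e2]
  linarith

end Sobolev

/-! ### Local strong convergence of weakly convergent Sobolev maps -/

/-- Dominated convergence in `L_p` for uniformly bounded functions vanishing outside a common set
of finite measure. -/
theorem tendsto_eLpNorm_zero_of_bounded {α : Type*} {mα : MeasurableSpace α} {μ : Measure α}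
    {p : ℝ≥0∞} (hp0 : p ≠ 0) (hp : p ≠ ∞) {u : ℕ → α → ℝ} (hu : ∀ k, Measurable (u k))
    {S : Set α} (hS : MeasurableSet S) (hμ : μ S ≠ ∞) (hu0 : ∀ k, ∀ x ∉ S, u k x = 0)
    {M : ℝ≥0∞} (hM : M ≠ ∞) (hb : ∀ k x, ‖u k x‖ₑ ≤ M)
    (hlim : ∀ x, Tendsto (fun k => u k x) atTop (𝓝 0)) :
    Tendsto (fun k => eLpNorm (u k) p μ) atTop (𝓝 0) := by
  have hr : 0 < p.toReal := ENNReal.toReal_pos hp0 hp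
  simp_rw [eLpNorm_eq_lintegral_rpow_enorm_toReal hp0 hp]
  have h : Tendsto (fun k => ∫⁻ x, ‖u k x‖ₑ ^ p.toReal ∂μ) atTop (𝓝 (∫⁻ _, 0 ∂μ)) := by
    refine tendsto_lintegral_of_dominated_convergence (S.indicator fun _ => M ^ p.toReal)
      (fun k => (hu k).enorm.pow_const _) (fun k => Eventually.of_forall fun x => ?_) ?_
      (Eventually.of_forall fun x => ?_)
    · by_cases hx : x ∈ S
      · rw [Set.indicator_of_mem hx]
        exact ENNReal.rpow_le_rpow (hb k x) hr.le
      · simp [hu0 k x hx, hr]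
    · rw [lintegral_indicator_const hS]
      exact ENNReal.mul_ne_top (ENNReal.rpow_ne_top_of_nonneg hr.le hM) hμ
    · have h1 := ((hlim x).enorm).ennrpow_const p.toReal
      simpa [hr] using h1
  rw [lintegral_zero] at h
  have h2 := h.ennrpow_const (1 / p.toReal)
  rwa [ENNReal.zero_rpow_of_pos (by positivity)] at h2

namespace Sobolev

variable {n : ℕ} {Ω : Opens (Euc n)} {p : ℝ≥0∞} [Fact (1 ≤ p)]

theorem enorm_fst_le (φ : Sobolev Ω p) : ‖φ.1.1‖ₑ ≤ ‖φ‖ₑ := by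
  rw [← ofReal_norm, ← ofReal_norm]
  exact ENNReal.ofReal_le_ofReal (norm_fst_le φ.1)

theorem enorm_snd_le (φ : Sobolev Ω p) : ‖φ.1.2‖ₑ ≤ ‖φ‖ₑ := by
  rw [← ofReal_norm, ← ofReal_norm]
  exact ENNReal.ofReal_le_ofReal (norm_snd_le φ.1)

theorem eLpNorm_apply_le (φ : Sobolev Ω p) (i : Fin n) :
    eLpNorm (fun x => φ.1.1 x i) p (volume.restrict (Ω : Set (Euc n))) ≤ ‖φ‖ₑ := by
  refine le_trans ?_ (enorm_fst_le φ)
  rw [Lp.enorm_def]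
  exact eLpNorm_mono fun x => PiLp.norm_apply_le (φ.1.1 x) i

theorem eLpNorm_deriv_apply_le (φ : Sobolev Ω p) (v : Euc n) (i : Fin n) :
    eLpNorm (fun x => Sobolev.deriv φ x v i) p (volume.restrict (Ω : Set (Euc n))) ≤
      ‖v‖ₑ * ‖φ‖ₑ := by
  refine le_trans ?_ (mul_le_mul_right (enorm_snd_le φ) _)
  rw [Lp.enorm_def, ← ofReal_norm]
  refine eLpNorm_le_mul_eLpNorm_of_ae_le_mul (Eventually.of_forall fun x => ?_) p
  refine (PiLp.norm_apply_le (Sobolev.deriv φ x v) i).trans ?_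
  rw [mul_comm]
  exact (Sobolev.deriv φ x).le_opNorm v

/-- The directional derivatives of `χ φ_i` are bounded in `L_p` by the Sobolev norm of `φ`,
uniformly in `φ` and linearly in the direction. -/
theorem exists_eLpNorm_cutDeriv_le (χ : 𝓓(Ω, ℝ)) (i : Fin n) :
    ∃ A : ℝ≥0∞, A ≠ ∞ ∧ ∀ (φ : Sobolev Ω p) (v : Euc n),
      eLpNorm (cutDeriv χ φ i v) p volume ≤ ‖v‖ₑ * (A * ‖φ‖ₑ) := by
  let ν := volume.restrict (Ω : Set (Euc n))
  have hp : (1 : ℝ≥0∞) ≤ p := Fact.out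
  have h1 : MemLp χ ∞ ν := χ.continuous.memLp_top_of_hasCompactSupport χ.hasCompactSupport _
  have h2 : MemLp (fderiv ℝ χ) ∞ ν :=
    (χ.contDiff.continuous_fderiv (by simp)).memLp_top_of_hasCompactSupport
      (χ.hasCompactSupport.fderiv ℝ) _
  refine ⟨eLpNorm χ ∞ ν + eLpNorm (fderiv ℝ χ) ∞ ν, ENNReal.add_ne_top.2 ⟨h1.2.ne, h2.2.ne⟩,
    fun φ v => ?_⟩
  have h3 : eLpNorm (testDeriv χ v) ∞ ν ≤ ‖v‖ₑ * eLpNorm (fderiv ℝ χ) ∞ ν := by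
    rw [← ofReal_norm]
    refine eLpNorm_le_mul_eLpNorm_of_ae_le_mul (Eventually.of_forall fun x => ?_) _
    rw [mul_comm]
    exact (fderiv ℝ χ x).le_opNorm v
  calc eLpNorm (cutDeriv χ φ i v) p volume
      ≤ eLpNorm (fun x => χ x * Sobolev.deriv φ x v i) p volume +
          eLpNorm (fun x => testDeriv χ v x * φ.1.1 x i) p volume :=
        eLpNorm_add_le (memLp_testFunction_mul χ (memLp_deriv_apply φ v i)).1
          (memLp_testFunction_mul (testDeriv χ v) (memLp_apply φ i)).1 hp
    _ ≤ eLpNorm χ ∞ ν * (‖v‖ₑ * ‖φ‖ₑ) + (‖v‖ₑ * eLpNorm (fderiv ℝ χ) ∞ ν) * ‖φ‖ₑ := by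
        refine add_le_add ((eLpNorm_testFunction_mul_le χ (memLp_deriv_apply φ v i).1).trans
          (mul_le_mul_right (eLpNorm_deriv_apply_le φ v i) _))
          ((eLpNorm_testFunction_mul_le (testDeriv χ v) (memLp_apply φ i).1).trans
          (mul_le_mul' h3 (eLpNorm_apply_le φ i)))
    _ = ‖v‖ₑ * ((eLpNorm χ ∞ ν + eLpNorm (fderiv ℝ χ) ∞ ν) * ‖φ‖ₑ) := by ring

theorem mollify_cut (χ : 𝓓(Ω, ℝ)) (φ : Sobolev Ω p) (i : Fin n)
    (ρ : ContDiffBump (0 : Euc n)) (x : Euc n) :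
    mollify volume ρ (cut χ φ i) x = ∫ y in (Ω : Set (Euc n)),
      (ρ.normed volume (x - y) * χ y) * EuclideanSpace.proj (𝕜 := ℝ) i (φ.1.1 y) := by
  have e : ∀ y, (ρ.normed volume (x - y) * χ y) * EuclideanSpace.proj (𝕜 := ℝ) i (φ.1.1 y) =
      χ y * (ρ.normed volume (x - y) * φ.1.1 y i) := fun y => by
    change _ * φ.1.1 y i = _
    ring
  simp_rw [e]
  rw [integral_testFunction_mul]
  change ∫ t, ρ.normed volume t * cut χ φ i (x - t) = _
  rw [← integral_sub_left_eq_self _ volume x]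
  refine integral_congr_ae (Eventually.of_forall fun y => ?_)
  simp only [sub_sub_cancel, cut]
  ring

theorem exists_enorm_mollify_cut_le (χ : 𝓓(Ω, ℝ)) (i : Fin n) (ρ : ContDiffBump (0 : Euc n)) :
    ∃ A : ℝ≥0∞, A ≠ ∞ ∧ ∀ (φ : Sobolev Ω p) (x : Euc n),
      ‖mollify volume ρ (cut χ φ i) x‖ₑ ≤ A * ‖φ‖ₑ := by
  let ν := volume.restrict (Ω : Set (Euc n))
  have hp : (1 : ℝ≥0∞) ≤ p := Fact.out
  have hs := (ENNReal.HolderConjugate.conjExponent hp).symm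
  obtain ⟨R, hR⟩ := ρ.hasCompactSupport_normed.exists_bound_of_continuous
    (ρ.continuous_normed (μ := (volume : Measure (Euc n))))
  have hχ : MemLp χ p.conjExponent ν :=
    χ.continuous.memLp_of_hasCompactSupport χ.hasCompactSupport
  refine ⟨ENNReal.ofReal R * eLpNorm χ p.conjExponent ν,
    ENNReal.mul_ne_top ENNReal.ofReal_ne_top hχ.2.ne, fun φ x => ?_⟩
  rw [mollify_cut]
  have hc : Continuous fun y => ρ.normed (volume : Measure (Euc n)) (x - y) :=
    ρ.continuous_normed.comp (by fun_prop)
  refine (enorm_integral_mul_le (s := p.conjExponent) (p := p)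
    (hc.mul χ.continuous).aestronglyMeasurable (memLp_apply φ i).1).trans
      (mul_le_mul' ?_ (eLpNorm_apply_le φ i))
  refine eLpNorm_le_mul_eLpNorm_of_ae_le_mul (Eventually.of_forall fun y => ?_) _
  rw [Pi.mul_apply, norm_mul]
  exact mul_le_mul_of_nonneg_right (hR _) (norm_nonneg _)

theorem tendsto_mollify_cut {φ : ℕ → Sobolev Ω p} {φ₀ : Sobolev Ω p} (h : WeaklyConverges φ φ₀)
    (χ : 𝓓(Ω, ℝ)) (i : Fin n) (ρ : ContDiffBump (0 : Euc n)) (x : Euc n) :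
    Tendsto (fun k => mollify volume ρ (cut χ (φ k) i) x) atTop
      (𝓝 (mollify volume ρ (cut χ φ₀ i) x)) := by
  have hp : (1 : ℝ≥0∞) ≤ p := Fact.out
  have hs := (ENNReal.HolderConjugate.conjExponent hp).symm
  simp_rw [mollify_cut]
  have hc : Continuous fun y => ρ.normed (volume : Measure (Euc n)) (x - y) :=
    ρ.continuous_normed.comp (by fun_prop)
  have ha : MemLp (fun y => ρ.normed (volume : Measure (Euc n)) (x - y) * χ y) p.conjExponent
      (volume.restrict (Ω : Set (Euc n))) :=
    (hc.mul χ.continuous).memLp_of_hasCompactSupport χ.hasCompactSupport.mul_left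
  exact (h.map ((ContinuousLinearMap.fst ℝ _ _).comp (Sobolev Ω p).subtypeL)).tendsto_integral ha
    (EuclideanSpace.proj i)

/-- Rellich's theorem, for a weakly convergent sequence: after multiplication by a test function the
components converge in norm. The modulus of continuity in `L_p` is uniform along the sequence, so
that mollification approximates all its members at the same rate, while the mollified functions
converge pointwise and boundedly. -/
theorem tendstoInLp_cut (hp : p ≠ ∞) {φ : ℕ → Sobolev Ω p} {φ₀ : Sobolev Ω p}
    (h : WeaklyConverges φ φ₀) (χ : 𝓓(Ω, ℝ)) (i : Fin n) :
    TendstoInLp p volume atTop (fun k => cut χ (φ k) i) (cut χ φ₀ i) := by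
  have hp1 : (1 : ℝ≥0∞) ≤ p := Fact.out
  obtain ⟨C, hC⟩ := h.exists_norm_le
  let B : ℝ≥0∞ := ENNReal.ofReal C + ‖φ₀‖ₑ
  have hB : B ≠ ∞ := ENNReal.add_ne_top.2 ⟨ENNReal.ofReal_ne_top, enorm_ne_top⟩
  have hφB : ∀ k, ‖φ k‖ₑ ≤ B := fun k => le_add_right <| by
    rw [← ofReal_norm]
    exact ENNReal.ofReal_le_ofReal (hC k)
  have hφ₀B : ‖φ₀‖ₑ ≤ B := le_add_self
  obtain ⟨A, hA, hAle⟩ := exists_eLpNorm_cutDeriv_le (p := p) χ i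
  have hK : IsCompact (Metric.cthickening 1 (tsupport χ)) := χ.hasCompactSupport.isCompact.cthickening
  have hmeas : ∀ (ρ : ContDiffBump (0 : Euc n)) (ψ : Sobolev Ω p),
      Continuous (mollify volume ρ (cut χ ψ i)) := fun ρ ψ =>
    (contDiff_mollify ρ ((memLp_cut χ ψ i).locallyIntegrable hp1)).continuous
  have happrox : ∀ (ρ : ContDiffBump (0 : Euc n)) (ψ : Sobolev Ω p), ‖ψ‖ₑ ≤ B →
      eLpNorm (mollify volume ρ (cut χ ψ i) - cut χ ψ i) p volume ≤
        ENNReal.ofReal ρ.rOut * (A * B) := by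
    intro ρ ψ hψ
    refine eLpNorm_mollify_sub_le ρ hp1 hp (memLp_cut χ ψ i) fun y hy => ?_
    refine ((hasWeakLineDeriv_cut χ ψ i y).eLpNorm_translate_sub_le hp1 hp (memLp_cut χ ψ i)
      (memLp_cutDeriv χ ψ i y).1).trans ((hAle ψ y).trans ?_)
    refine mul_le_mul' ?_ (mul_le_mul' le_rfl hψ)
    rw [← ofReal_norm]
    exact ENNReal.ofReal_le_ofReal hy.le
  have hmoll : ∀ ρ : ContDiffBump (0 : Euc n), ρ.rOut ≤ 1 →
      Tendsto (fun k => eLpNorm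
        (mollify volume ρ (cut χ (φ k) i) - mollify volume ρ (cut χ φ₀ i)) p volume)
        atTop (𝓝 0) := by
    intro ρ hρ
    obtain ⟨M, hM, hMle⟩ := exists_enorm_mollify_cut_le (p := p) χ i ρ
    have hz : ∀ (ψ : Sobolev Ω p), ∀ x ∉ Metric.cthickening 1 (tsupport χ),
        mollify volume ρ (cut χ ψ i) x = 0 := fun ψ x hx =>
      mollify_eq_zero_of_notMem_cthickening (K := tsupport χ)
        (fun y hy => by simp [cut, image_eq_zero_of_notMem_tsupport hy]) ρ hρ hx
    refine tendsto_eLpNorm_zero_of_bounded (zero_lt_one.trans_le hp1).ne' hp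
      (fun k => ((hmeas ρ _).sub (hmeas ρ _)).measurable) hK.measurableSet hK.measure_lt_top.ne
      (fun k x hx => by simp [hz _ x hx]) (M := M * B + M * B)
      (ENNReal.add_ne_top.2 ⟨ENNReal.mul_ne_top hM hB, ENNReal.mul_ne_top hM hB⟩)
      (fun k x => ?_) fun x => ?_
    · exact (enorm_sub_le).trans (add_le_add ((hMle _ x).trans (mul_le_mul' le_rfl (hφB k)))
        ((hMle _ x).trans (mul_le_mul' le_rfl hφ₀B)))
    · simpa using (tendsto_mollify_cut h χ i ρ x).sub_const (mollify volume ρ (cut χ φ₀ i) x)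
  obtain ⟨ρ, hρ, hρ1⟩ := exists_seq_contDiffBump (E := Euc n)
  refine ⟨fun k => memLp_cut χ _ i, memLp_cut χ _ i, ENNReal.tendsto_nhds_zero.2 fun ε hε => ?_⟩
  have hsmall : Tendsto (fun j => ENNReal.ofReal (ρ j).rOut * (A * B)) atTop (𝓝 0) := by
    have := ENNReal.Tendsto.mul_const (b := A * B) (ENNReal.tendsto_ofReal hρ)
      (Or.inr (ENNReal.mul_ne_top hA hB))
    simpa using this
  have hε3 : 0 < ε / 3 := ENNReal.div_pos hε.ne' (by simp)
  obtain ⟨j, hj⟩ := (ENNReal.tendsto_nhds_zero.1 hsmall (ε / 3) hε3).exists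
  filter_upwards [ENNReal.tendsto_nhds_zero.1 (hmoll (ρ j) (hρ1 j)) (ε / 3) hε3] with k hk
  let u : Sobolev Ω p → Euc n → ℝ := fun ψ => mollify volume (ρ j) (cut χ ψ i)
  have hm : ∀ ψ, AEStronglyMeasurable (u ψ) volume := fun ψ => (hmeas _ ψ).aestronglyMeasurable
  have hm' : ∀ ψ : Sobolev Ω p, AEStronglyMeasurable (cut χ ψ i) volume :=
    fun ψ => (memLp_cut χ ψ i).1
  have e : cut χ (φ k) i - cut χ φ₀ i =
      -(u (φ k) - cut χ (φ k) i) + (u (φ k) - u φ₀) + (u φ₀ - cut χ φ₀ i) := by abel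
  calc eLpNorm (cut χ (φ k) i - cut χ φ₀ i) p volume
      ≤ eLpNorm (u (φ k) - cut χ (φ k) i) p volume + eLpNorm (u (φ k) - u φ₀) p volume +
          eLpNorm (u φ₀ - cut χ φ₀ i) p volume := by
        rw [e]
        refine (eLpNorm_add_le ((((hm _).sub (hm' _)).neg).add ((hm _).sub (hm _)))
          ((hm _).sub (hm' _)) hp1).trans (add_le_add ((eLpNorm_add_le ((hm _).sub (hm' _)).neg
          ((hm _).sub (hm _)) hp1).trans_eq ?_) le_rfl)
        rw [eLpNorm_neg]
    _ ≤ ε / 3 + ε / 3 + ε / 3 :=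
        add_le_add (add_le_add ((happrox _ _ (hφB k)).trans hj) hk)
          ((happrox _ _ hφ₀B).trans hj)
    _ = ε := ENNReal.add_thirds ε

end Sobolev

/-! ### Minors of the weak derivative -/

namespace Sobolev

/-- A cutoff function for the support of `θ`. Its derivative vanishes on that support, so that
`D(χ φ) = Dφ` there. -/
theorem exists_cutoff {n : ℕ} {Ω : Opens (Euc n)} (θ : 𝓓(Ω, ℝ)) :
    ∃ χ : 𝓓(Ω, ℝ), ∀ x ∈ tsupport θ, χ x = 1 ∧ fderiv ℝ χ x = 0 := by
  obtain ⟨L, hL, hθL, hLΩ⟩ := exists_compact_between θ.hasCompactSupport.isCompact Ω.isOpen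
    θ.tsupport_subset
  obtain ⟨f, hf, hrange, hsupp, h1⟩ := exists_contMDiff_support_eq_eq_one_iff (n := ⊤)
    (modelWithCornersSelf ℝ (Euc n)) (isOpen_interior (s := L)) (isClosed_tsupport θ) hθL
  have hts : tsupport f ⊆ L := by
    rw [tsupport, hsupp]
    exact closure_minimal interior_subset hL.isClosed
  refine ⟨⟨f, hf.contDiff, HasCompactSupport.of_support_subset_isCompact hL
    ((subset_tsupport f).trans hts), hts.trans hLΩ⟩, fun x hx => ⟨(h1 x).1 hx, ?_⟩⟩
  -- the value `1` is the maximum of the cutoff function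
  refine IsLocalMax.fderiv_eq_zero (Eventually.of_forall fun y => ?_)
  change f y ≤ f x
  rw [(h1 x).1 hx]
  exact (hrange ⟨y, rfl⟩).2

variable {n : ℕ} [NeZero n] {Ω : Opens (Euc n)}

theorem memLp_minor (φ : Sobolev Ω (n : ℝ≥0∞)) {m : ℕ} (hm : m ≤ n) (p q : Fin m ↪o Fin n) :
    MemLp (minor φ p q) ((n : ℝ≥0∞) / (m : ℝ≥0∞)) (volume.restrict (Ω : Set (Euc n))) :=
  memLp_det (NeZero.ne n) hm fun a b =>
    memLp_deriv_apply φ (EuclideanSpace.single (q b) 1) (p a)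

/-- Expansion of a minor along its first row, integrated by parts: a minor of order `m + 1` is, in
the sense of distributions, a divergence whose entries are a component of `φ` times minors of
order `m`. -/
theorem integral_testFunction_mul_minor (φ : Sobolev Ω (n : ℝ≥0∞)) {m : ℕ} (hm : m + 1 ≤ n)
    (θ : 𝓓(Ω, ℝ)) (p q : Fin (m + 1) ↪o Fin n) :
    ∫ x in (Ω : Set (Euc n)), θ x * minor φ p q x =
      -∑ j : Fin (m + 1), (-1) ^ (j : ℕ) * ∫ x in (Ω : Set (Euc n)),
        cut (testDeriv θ (EuclideanSpace.single (q j) 1)) φ (p 0) x *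
          minor φ ((Fin.succOrderEmb m).trans p) ((Fin.succAboveOrderEmb j).trans q) x := by
  have hn : n ≠ 0 := NeZero.ne n
  obtain ⟨χ, hχ⟩ := exists_cutoff θ
  let e : Fin n → Euc n := fun j => EuclideanSpace.single j 1
  let M : Fin (m + 1) → Euc n → ℝ := fun j =>
    minor φ ((Fin.succOrderEmb m).trans p) ((Fin.succAboveOrderEmb j).trans q)
  -- the first row carries the test function, the others the cutoff function
  let c : Fin (m + 1) → 𝓓(Ω, ℝ) := Fin.cons θ fun _ => χ
  have key : ∫ x, (Matrix.of fun i j => cutDeriv (c i) φ (p i) (e (q j)) x).det = 0 :=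
    integral_det_eq_zero_of_hasWeakLineDeriv hm (g := fun i => cut (c i) φ (p i))
      (fun i => memLp_cut _ φ _) (fun i j => memLp_cutDeriv _ φ _ _)
      (fun i j => hasWeakLineDeriv_cut _ φ _ _) θ.hasCompactSupport.isCompact
      (fun x hx => by simp [cut, c, image_eq_zero_of_notMem_tsupport hx])
      (fun j x hx => cutDeriv_eq_zero_of_notMem_tsupport θ φ _ _ hx)
  have hrow : ∀ x ∉ tsupport θ,
      (Matrix.of fun i j => cutDeriv (c i) φ (p i) (e (q j)) x).det = 0 := fun x hx =>
    Matrix.det_eq_zero_of_row_eq_zero 0 fun j =>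
      cutDeriv_eq_zero_of_notMem_tsupport θ φ (p 0) (e (q j)) hx
  have hpt : ∀ x, (Matrix.of fun i j => cutDeriv (c i) φ (p i) (e (q j)) x).det =
      θ x * minor φ p q x + ∑ j : Fin (m + 1),
        (-1) ^ (j : ℕ) * (cut (testDeriv θ (e (q j))) φ (p 0) x * M j x) := by
    intro x
    by_cases hx : x ∈ tsupport θ
    · have hM : minor φ p q x = ∑ j : Fin (m + 1),
          (-1) ^ (j : ℕ) * Sobolev.deriv φ x (e (q j)) (p 0) * M j x := by
        rw [minor, Matrix.det_succ_row_zero]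
        rfl
      rw [Matrix.det_succ_row_zero, hM, Finset.mul_sum, ← Finset.sum_add_distrib]
      refine Finset.sum_congr rfl fun j _ => ?_
      have hsub : (Matrix.of fun i j => cutDeriv (c i) φ (p i) (e (q j)) x).submatrix Fin.succ
          j.succAbove = (jacobiMatrix (Sobolev.deriv φ x)).submatrix
            ((Fin.succOrderEmb m).trans p) ((Fin.succAboveOrderEmb j).trans q) := by
        ext a b
        simp [cutDeriv, c, jacobiMatrix, hχ x hx, e]
      rw [hsub]
      change _ * (θ x * Sobolev.deriv φ x (e (q j)) (p 0) +
        fderiv ℝ θ x (e (q j)) * φ.1.1 x (p 0)) * M j x = _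
      simp only [cut, testDeriv_apply]
      ring
    · have h1 := image_eq_zero_of_notMem_tsupport hx
      have h2 : fderiv ℝ θ x = 0 := image_eq_zero_of_notMem_tsupport fun h =>
        hx (tsupport_fderiv_subset ℝ h)
      rw [hrow x hx]
      simp [cut, h1, h2]
  have hr := one_le_natCast_div hn hm
  have hloc : ∀ {f : Euc n → ℝ} (η : 𝓓(Ω, ℝ)),
      MemLp f ((n : ℝ≥0∞) / ((m + 1 : ℕ) : ℝ≥0∞)) (volume.restrict (Ω : Set (Euc n))) →
      Integrable (fun x => η x * f x) (volume.restrict (Ω : Set (Euc n))) := fun η hf =>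
    (hf.locallyIntegrable hr).integrable_smul_left_of_hasCompactSupport η.continuous
      η.hasCompactSupport
  have hi1 := hloc θ (memLp_minor φ hm p q)
  have hi2 : ∀ j : Fin (m + 1), Integrable (fun x =>
      (-1) ^ (j : ℕ) * (cut (testDeriv θ (e (q j))) φ (p 0) x * M j x))
      (volume.restrict (Ω : Set (Euc n))) := by
    intro j
    have := holderTriple_natCast_div hn m
    have hmul : MemLp (fun x => M j x * φ.1.1 x (p 0))
        ((n : ℝ≥0∞) / ((m + 1 : ℕ) : ℝ≥0∞)) (volume.restrict (Ω : Set (Euc n))) :=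
      (memLp_apply φ (p 0)).mul (memLp_minor φ (by omega) _ _)
    refine ((hloc (testDeriv θ (e (q j))) hmul).const_mul ((-1) ^ (j : ℕ))).congr
      (Eventually.of_forall fun x => ?_)
    simp only [cut]
    ring
  have hΩ : ∫ x in (Ω : Set (Euc n)),
      (Matrix.of fun i j => cutDeriv (c i) φ (p i) (e (q j)) x).det = 0 := by
    rw [← key]
    refine setIntegral_eq_integral_of_forall_compl_eq_zero fun x hx => ?_
    exact hrow x fun h => hx (θ.tsupport_subset h)
  simp_rw [hpt] at hΩ
  rw [integral_add hi1 (integrable_finsetSum _ fun j _ => hi2 j),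
    integral_finsetSum _ fun j _ => hi2 j] at hΩ
  simp_rw [integral_const_mul] at hΩ
  exact eq_neg_of_add_eq_zero_left hΩ

end Sobolev

theorem holderConjugate_natCast_div {n m : ℕ} (hn : n ≠ 0) (hmn : m ≤ n) :
    ENNReal.HolderConjugate ((n : ℝ≥0∞) / ((n - m : ℕ) : ℝ≥0∞))
      ((n : ℝ≥0∞) / (m : ℝ≥0∞)) := by
  have hn' : (n : ℝ≥0∞) ≠ 0 := by exact_mod_cast hn
  rw [ENNReal.holderConjugate_iff, ENNReal.inv_div (Or.inl (by simp)) (Or.inr hn'),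
    ENNReal.inv_div (Or.inl (by simp)) (Or.inr hn'), ENNReal.div_add_div_same]
  have h : ((n - m : ℕ) : ℝ≥0∞) + m = n := by
    exact_mod_cast Nat.sub_add_cancel hmn
  rw [h]
  exact ENNReal.div_self hn' (by simp)

namespace WeaklyConvergesInLp

variable {n : ℕ} {Ω : Opens (Euc n)} {r s : ℝ≥0∞} {f : ℕ → Euc n → ℝ} {g : Euc n → ℝ}

theorem tendsto_integral_mul [s.HolderConjugate r] (h : WeaklyConvergesInLp Ω r f g)
    {a : ℕ → Euc n → ℝ} {a₀ : Euc n → ℝ}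
    (ha : TendstoInLp s (volume.restrict (Ω : Set (Euc n))) atTop a a₀) :
    Tendsto (fun k => ∫ x in (Ω : Set (Euc n)), a k x * f k x) atTop
      (𝓝 (∫ x in (Ω : Set (Euc n)), a₀ x * g x)) := by
  obtain ⟨_, hf, hg, hw⟩ := h
  have h1 := hw.tendsto_integral_mul ha
  have e : ∀ {u b : Euc n → ℝ} (hu : MemLp u r (volume.restrict (Ω : Set (Euc n)))),
      ∫ x in (Ω : Set (Euc n)), b x * (hu.toLp u : Euc n → ℝ) x = ∫ x in (Ω : Set (Euc n)), b x * u x := by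
    intro u b hu
    refine integral_congr_ae ?_
    filter_upwards [hu.coeFn_toLp] with x hx
    rw [hx]
  simpa only [e] using h1

/-- A weak limit in `L_r` is determined by the limits of the integrals against test functions. -/
theorem ae_eq_of_tendsto_integral (h : WeaklyConvergesInLp Ω r f g) {M : Euc n → ℝ}
    (hM : MemLp M r (volume.restrict (Ω : Set (Euc n))))
    (hlim : ∀ θ : 𝓓(Ω, ℝ), Tendsto (fun k => ∫ x in (Ω : Set (Euc n)), θ x * f k x) atTop
      (𝓝 (∫ x in (Ω : Set (Euc n)), θ x * M x))) :
    g =ᵐ[volume.restrict (Ω : Set (Euc n))] M := by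
  obtain ⟨⟨hr⟩, hf, hg, hw⟩ := id h
  have hs := (ENNReal.HolderConjugate.conjExponent hr).symm
  have hloc : LocallyIntegrable (g - M) (volume.restrict (Ω : Set (Euc n))) :=
    (hg.sub hM).locallyIntegrable hr
  have hae := Ω.isOpen.ae_eq_zero_of_integral_contDiff_smul_eq_zero
    (μ := volume.restrict (Ω : Set (Euc n))) (hloc.locallyIntegrableOn _) fun t ht htc hts => by
      let θ : 𝓓(Ω, ℝ) := ⟨t, ht, htc, hts⟩
      have h1 := h.tendsto_integral_mul (TendstoInLp.const (l := atTop)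
        (θ.continuous.memLp_of_hasCompactSupport (p := r.conjExponent)
          (μ := volume.restrict (Ω : Set (Euc n))) θ.hasCompactSupport))
      have h2 := tendsto_nhds_unique h1 (hlim θ)
      have i1 := (hg.locallyIntegrable hr).integrable_smul_left_of_hasCompactSupport ht.continuous
        htc
      have i2 := (hM.locallyIntegrable hr).integrable_smul_left_of_hasCompactSupport ht.continuous
        htc
      simp_rw [Pi.sub_apply, smul_sub]
      rw [integral_sub i1 i2, sub_eq_zero]
      exact h2
  filter_upwards [hae, ae_restrict_mem Ω.isOpen.measurableSet] with x hx hxΩ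
  exact sub_eq_zero.1 (hx hxΩ)

end WeaklyConvergesInLp

namespace Sobolev

variable {n : ℕ} [NeZero n] {Ω : Opens (Euc n)}

theorem minor_fin_zero (φ : Sobolev Ω (n : ℝ≥0∞)) (p q : Fin 0 ↪o Fin n) (x : Euc n) :
    minor φ p q x = 1 := Matrix.det_isEmpty

/-- Minors of order `m + 1` converge as distributions once the products of the components with the
minors of order `m` do. -/
theorem tendsto_integral_minor_succ {φ : ℕ → Sobolev Ω (n : ℝ≥0∞)} {φ₀ : Sobolev Ω (n : ℝ≥0∞)}
    {m : ℕ} (hm : m + 1 ≤ n)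
    (h : ∀ (p q : Fin m ↪o Fin n) (χ : 𝓓(Ω, ℝ)) (i : Fin n),
      Tendsto (fun k => ∫ x in (Ω : Set (Euc n)), cut χ (φ k) i x * minor (φ k) p q x) atTop
        (𝓝 (∫ x in (Ω : Set (Euc n)), cut χ φ₀ i x * minor φ₀ p q x)))
    (p q : Fin (m + 1) ↪o Fin n) (θ : 𝓓(Ω, ℝ)) :
    Tendsto (fun k => ∫ x in (Ω : Set (Euc n)), θ x * minor (φ k) p q x) atTop
      (𝓝 (∫ x in (Ω : Set (Euc n)), θ x * minor φ₀ p q x)) := by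
  simp_rw [integral_testFunction_mul_minor _ hm]
  exact (tendsto_finsetSum _ fun j _ => (h _ _ _ _).const_mul _).neg

/-- The products of components with minors of order `m` converge as distributions. The induction
step pairs the strong convergence of the components with the weak convergence of the minors, whose
limits are already identified. -/
theorem tendsto_integral_cut_mul_minor {φ : ℕ → Sobolev Ω (n : ℝ≥0∞)}
    {φ₀ : Sobolev Ω (n : ℝ≥0∞)} {H : (m : ℕ) → (Fin m ↪o Fin n) → (Fin m ↪o Fin n) → Euc n → ℝ}
    (hφ : WeaklyConverges φ φ₀)
    (hH : ∀ m : ℕ, 1 ≤ m → m ≤ n → ∀ p q : Fin m ↪o Fin n,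
      WeaklyConvergesInLp Ω ((n : ℝ≥0∞) / (m : ℝ≥0∞)) (fun k => minor (φ k) p q) (H m p q))
    (m : ℕ) (hm : m < n) (p q : Fin m ↪o Fin n) (χ : 𝓓(Ω, ℝ)) (i : Fin n) :
    Tendsto (fun k => ∫ x in (Ω : Set (Euc n)), cut χ (φ k) i x * minor (φ k) p q x) atTop
      (𝓝 (∫ x in (Ω : Set (Euc n)), cut χ φ₀ i x * minor φ₀ p q x)) := by
  have hn : n ≠ 0 := NeZero.ne n
  have hs1 : ∀ {m : ℕ}, m < n → (n : ℝ≥0∞) / ((n - m : ℕ) : ℝ≥0∞) ≤ n := fun {m} hm =>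
    ENNReal.div_le_of_le_mul (le_mul_of_one_le_right' (by exact_mod_cast Nat.sub_pos_of_lt hm))
  have hstrong : ∀ {m : ℕ}, m < n → ∀ (χ : 𝓓(Ω, ℝ)) (i : Fin n), TendstoInLp ((n : ℝ≥0∞) / ((n - m : ℕ) : ℝ≥0∞))
      (volume.restrict (Ω : Set (Euc n))) atTop (fun k => cut χ (φ k) i) (cut χ φ₀ i) := by
    intro m hm χ i
    refine ((tendstoInLp_cut (ENNReal.natCast_ne_top n) hφ χ i).mono_exponent_of_eq_zero
      χ.hasCompactSupport.isCompact.measurableSet χ.hasCompactSupport.isCompact.measure_lt_top.ne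
      (hs1 hm) (fun k x hx => ?_) fun x hx => ?_).restrict _
    all_goals simp [cut, image_eq_zero_of_notMem_tsupport hx]
  induction m generalizing χ i with
  | zero =>
    simp_rw [minor_fin_zero, mul_one]
    have := hstrong (m := 0) hm χ i
    simp only [Nat.sub_zero, ENNReal.div_self (Nat.cast_ne_zero.2 hn)
      (ENNReal.natCast_ne_top n)] at this
    exact this.tendsto_integral
  | succ m ih =>
    have hlim := tendsto_integral_minor_succ hm.le
      (fun p q χ i => ih (by omega) p q χ i) p q
    have hHM := (hH (m + 1) (by omega) hm.le p q).ae_eq_of_tendsto_integral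
      (memLp_minor φ₀ hm.le p q) hlim
    have := holderConjugate_natCast_div hn hm.le
    have h1 := (hH (m + 1) (by omega) hm.le p q).tendsto_integral_mul (hstrong hm χ i)
    have e : ∫ x in (Ω : Set (Euc n)), cut χ φ₀ i x * H (m + 1) p q x =
        ∫ x in (Ω : Set (Euc n)), cut χ φ₀ i x * minor φ₀ p q x := by
      refine integral_congr_ae ?_
      filter_upwards [hHM] with x hx
      rw [hx]
    rwa [e] at h1

end Sobolev

theorem mainTheorem3 (n : ℕ) [NeZero n] (Ω : Opens (Euc n))
    (hconn : IsConnected (Ω : Set (Euc n)))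
    (hlip : HasLocallyLipschitzBoundary (Ω : Set (Euc n)))
    (φ : ℕ → Sobolev Ω (n : ℝ≥0∞)) (φ₀ : Sobolev Ω (n : ℝ≥0∞)) :
    (∀ m : ℕ, 1 ≤ m → m ≤ n → ∀ p q : Fin m ↪o Fin n,
      MemLp (Sobolev.minor φ₀ p q) ((n : ℝ≥0∞) / (m : ℝ≥0∞)) (volume.restrict (Ω : Set (Euc n)))) ∧
    ∀ H : (m : ℕ) → (Fin m ↪o Fin n) → (Fin m ↪o Fin n) → Euc n → ℝ,
      WeaklyConverges φ φ₀ →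
      (∀ m : ℕ, 1 ≤ m → m ≤ n → ∀ p q : Fin m ↪o Fin n,
        WeaklyConvergesInLp Ω ((n : ℝ≥0∞) / (m : ℝ≥0∞)) (fun k => Sobolev.minor (φ k) p q) (H m p q)) →
      ∀ m : ℕ, 1 ≤ m → m ≤ n → ∀ p q : Fin m ↪o Fin n,
        H m p q =ᵐ[volume.restrict (Ω : Set (Euc n))] Sobolev.minor φ₀ p q := by
  refine ⟨fun m _ hm p q => Sobolev.memLp_minor φ₀ hm p q, fun H hφ hH m hm1 hm p q => ?_⟩
  obtain ⟨k, rfl⟩ := Nat.exists_eq_add_of_le' hm1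
  exact (hH (k + 1) hm1 hm p q).ae_eq_of_tendsto_integral (Sobolev.memLp_minor φ₀ hm p q)
    (Sobolev.tendsto_integral_minor_succ hm
      (Sobolev.tendsto_integral_cut_mul_minor hφ hH k hm) p q)
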